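/- **Theorem 5.4.** Let $m>1$ and let $P\subset\mathbb R^{2m}$ be a $2m$-dimensional convex polytope with at least $2m+3$ vertices which is neighbourly, i.e. the convex hull of any $m$ vertices of $P$ is a proper face of $P$. Write $\mathcal V(Q)$ for the vertex set of a polytope $Q$ and $[\cdot]$ for convex hull. For a neighbourly $2m$-polytope $Q$, a $(2k-1)$-dimensional face $U$ of $Q$ is called *universal* if $[S,U]$ is a face of $Q$ for every $S\subseteq\mathcal V(Q)$ with $|S|\le m-k$; $\mathcal U_{2k-1}(Q)$ denotes the set of these faces. Let $x_1,\dots,x_m,y_1,\dots,y_m$ be distinct vertices of $P$, put $\Phi_0=\emptyset$ and $\Phi_j=[x_1,y_1,\dots,x_j,y_j]$, and assume that $\Phi_j\in\mathcal U_{2j-1}(P)$ for $j=1,\dots,m$. For $0\le j\le m$ let $\mathscr F_j$ be the set of facets of $P$ containing $\Phi_j$, let $\mathscr F_j=\emptyset$ for $j>m$, and let $\mathcal C=(\mathscr F_1\setminus\mathscr F_2)\cup(\mathscr F_3\setminus\mathscr F_4)\cup\cdots$. Let $\bar x\in\mathbb R^{2m}$ be a point that lies on the affine hull of no facet of $P$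 and such that, for every facet $F$ of $P$, the hyperplane $\operatorname{aff}F$ separates $\bar x$ from $P$ if and only if $F\in\mathcal C$. Let $P^+=[P,\bar x]$ (the polytope obtained by sewing $\bar x$ onto $P$). Let $0\le i<k<m$ be integers and let $U\in\mathcal U_{2k-1}(P)$ with $\Phi_i\subseteq U$ and $x_{i+1}\notin U$. Then $$U\in\mathcal U_{2k-1}(P^+)\iff i\text{ is even and }[U,\bar x,x_{i+1}]\in\mathcal U_{2k+1}(P^+).$$ -/

import Mathlib

namespace SewnPolytope

variable {E : Type*} [NormedAddCommGroup E] [NormedSpace ℝ E]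

/-- The dimension of (the affine hull of) a set. -/
noncomputable def affDim (A : Set E) : ℕ := Module.finrank ℝ (vectorSpan ℝ A)

/-- A convex polytope: the convex hull of a nonempty finite set of points. -/
def IsPolytope (P : Set E) : Prop :=
  ∃ s : Finset E, s.Nonempty ∧ P = convexHull ℝ (s : Set E)

/-- The vertex set of `P`. -/
abbrev vertices (P : Set E) : Set E := P.extremePoints ℝ

/-- `F` is a face of `P`: the intersection of `P` with a supporting hyperplane, or one of the
improper faces `∅`, `P`. -/
def IsFace (P F : Set E) : Prop := IsExposed ℝ P F

/-- `F` is a nonempty face of `P` of dimension `k`. -/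
def IsFaceOfDim (P : Set E) (k : ℕ) (F : Set E) : Prop :=
  F.Nonempty ∧ IsFace P F ∧ affDim F = k

/-- `F` is a facet of `P`: a face of dimension one less than `P`. -/
def IsFacet (P F : Set E) : Prop :=
  F.Nonempty ∧ IsFace P F ∧ affDim F + 1 = affDim P

/-- `P` is a neighbourly polytope: with `d = dim P`, any `⌊d / 2⌋` vertices of `P` determine
(i.e. their convex hull is) a proper face of `P`. -/
def IsNeighbourly (P : Set E) : Prop :=
  IsPolytope P ∧ ∀ S : Finset E, (S : Set E) ⊆ vertices P → S.card = affDim P / 2 →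
    IsFace P (convexHull ℝ (S : Set E)) ∧ convexHull ℝ (S : Set E) ≠ P

/-- `U` is a universal `k`-face of `P`: it is a `k`-face, and `[S, U]` is a face of `P` for every
set `S` of at most `⌊(d - k - 1) / 2⌋` vertices of `P`, where `d = dim P`. -/
def IsUniversalFace (P : Set E) (k : ℕ) (U : Set E) : Prop :=
  IsFaceOfDim P k U ∧
    ∀ S : Finset E, (S : Set E) ⊆ vertices P → S.card ≤ (affDim P - k - 1) / 2 →
      IsFace P (convexHull ℝ ((S : Set E) ∪ U))

/-- `Φ_j = [x_1, y_1, …, x_j, y_j]`; in particular `Φ_0 = ∅`. -/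
def towerFace (x y : ℕ → E) (j : ℕ) : Set E :=
  convexHull ℝ (x '' Set.Icc 1 j ∪ y '' Set.Icc 1 j)

/-- `x_1, …, x_m, y_1, …, y_m` are pairwise distinct vertices of `P` and `Φ_1, …, Φ_m` is a
universal tower in `P` (the values of `x` and `y` outside `{1, …, m}` play no role). -/
structure IsUniversalTower (P : Set E) (m : ℕ) (x y : ℕ → E) : Prop where
  x_mem : ∀ j ∈ Set.Icc 1 m, x j ∈ vertices P
  y_mem : ∀ j ∈ Set.Icc 1 m, y j ∈ vertices P
  x_injOn : Set.InjOn x (Set.Icc 1 m)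
  y_injOn : Set.InjOn y (Set.Icc 1 m)
  x_ne_y : ∀ j ∈ Set.Icc 1 m, ∀ l ∈ Set.Icc 1 m, x j ≠ y l
  universal : ∀ j ∈ Set.Icc 1 m, IsUniversalFace P (2 * j - 1) (towerFace x y j)

/-- `ℱ_j`: the facets of `P` that contain `Φ_j`, with `ℱ_j = ∅` for `j > m`. -/
def facetsThrough (P : Set E) (m : ℕ) (x y : ℕ → E) (j : ℕ) : Set (Set E) :=
  {F | j ≤ m ∧ IsFacet P F ∧ towerFace x y j ⊆ F}

/-- `𝒞(𝒯) = (ℱ_1 \ ℱ_2) ∪ (ℱ_3 \ ℱ_4) ∪ …`. -/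
def towerFacets (P : Set E) (m : ℕ) (x y : ℕ → E) : Set (Set E) :=
  ⋃ r : ℕ, facetsThrough P m x y (2 * r + 1) \ facetsThrough P m x y (2 * r + 2)

/-- The point `z`, not in `aff F`, is beyond the facet `F` of `P`: `aff F` separates `P` from
`z`. -/
def IsBeyond (P F : Set E) (z : E) : Prop :=
  z ∉ affineSpan ℝ F ∧ ∀ p ∈ P, (affineSpan ℝ F).WOppSide p z

/-- The point `z`, not in `aff F`, is beneath the facet `F` of `P`: it is not beyond `F`. -/
def IsBeneath (P F : Set E) (z : E) : Prop :=
  z ∉ affineSpan ℝ F ∧ ¬ IsBeyond P F z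

/-- The point `z` lies exactly beyond the set `C` of facets of `P`. -/
def IsExactlyBeyond (P : Set E) (C : Set (Set E)) (z : E) : Prop :=
  (∀ F ∈ C, IsBeyond P F z) ∧ ∀ F, IsFacet P F → F ∉ C → IsBeneath P F z

/-- `P⁺ = [P, z]`. -/
def sewn (P : Set E) (z : E) : Set E := convexHull ℝ (insert z P)

end SewnPolytope

/-! In homogeneous coordinates, faces are zero sets of nonnegative linear forms, and affine
dependences of the vertices are linear dependences. By Gordan's alternative, an independent vertex
set `U` stays a face after adding any at most `r` further vertices exactly when every nontrivial
dependence has more than `r` positive coefficients outside `U` (`MinPos`). Replacing `c` by `-c`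
gives the same bound for negative coefficients, so the theorem becomes a count of signs.

Write `x'` for `x (i + 1)` and `z` for the sewn point. Sewing enters through facets that contain `T
j` but miss a point of `T (j + 1)`: `z` is beyond them for odd `j` and beneath them for even `j`.
Two facts follow. `minPos_sewn`: every nontrivial dependence has more than `m - i - 1` positive
coefficients outside `T i ∪ {x', z}`. `lt_card_neg`: if `x'` has a nonnegative coefficient and that
of `z` is positive (`i` even) or negative (`i` odd), then more than `m - i` vertices of `P` outside
`T i` have negative coefficients. Together these signs occupy at least `2m - 2i + 1` places outside
`T i ∪ {x', z}`.

If `U` survives, both nontrivial claims contradict this count by producing a dependence with at most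
`2m - 2i` nonzero places there. For odd `i`, one expresses `z` and `x'` in a basis containing `U`
and cancels a common positive coefficient (`even_of_minPos`). For even `i`, a dependence violating
universality of `U ∪ {x', z}` is shrunk to one of minimal support modulo `U`
(`minPos_insert_of_minPos`). The converse is direct: a violating dependence is nonpositive at `z`
and `x'`, and a facet beneath which `z` lies forces its coefficient at `z` to vanish, so it already
violates universality in `P` (`minPos_of_minPos_insert`). -/

namespace SewnPolytope

/-! ### Sign patterns of dependences and faces. -/

section Dependences

variable {α W : Type*} [AddCommGroup W] [Module ℝ W] {h : α → W}

/-- `c` is a linear dependence of the vectors `h v`, `v ∈ X`. -/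
def IsDep (h : α → W) (X : Finset α) (c : α → ℝ) : Prop := ∑ v ∈ X, c v • h v = 0

/-- Some linear form vanishes on `h '' A` and is positive on the rest of `h '' X`. -/
def FaceOn (h : α → W) (X A : Finset α) : Prop :=
  ∃ φ : W →ₗ[ℝ] ℝ, (∀ v ∈ A, φ (h v) = 0) ∧ ∀ v ∈ X, v ∉ A → 0 < φ (h v)

lemma IsDep.neg {X : Finset α} {c : α → ℝ} (hc : IsDep h X c) : IsDep h X (-c) := by
  simpa [IsDep] using hc

lemma IsDep.apply {X : Finset α} {c : α → ℝ} (hc : IsDep h X c) (φ : W →ₗ[ℝ] ℝ) :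
    ∑ v ∈ X, c v * φ (h v) = 0 := by
  have := congrArg φ hc
  simpa [map_sum] using this

lemma IsDep.add_const_mul {X : Finset α} {c d : α → ℝ} (hc : IsDep h X c) (hd : IsDep h X d) (s : ℝ) :
    IsDep h X (fun v => c v + s * d v) := by
  unfold IsDep at *
  simp only [add_smul, mul_smul, Finset.sum_add_distrib, ← Finset.smul_sum, hc, hd, smul_zero,
    add_zero]

/-- If the terms of `∑ c v * φ (h v)` are nonpositive then they all vanish. -/
lemma IsDep.eq_zero_of_nonpos {X : Finset α} {c : α → ℝ} (hc : IsDep h X c) (φ : W →ₗ[ℝ] ℝ)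
    (hφ : ∀ v ∈ X, c v * φ (h v) ≤ 0) : ∀ v ∈ X, c v * φ (h v) = 0 :=
  (Finset.sum_eq_zero_iff_of_nonpos hφ).1 (hc.apply φ)

lemma IsDep.restrict {X Y : Finset α} {c : α → ℝ} (hXY : X ⊆ Y) (hc : IsDep h Y c)
    (h0 : ∀ v ∈ Y, v ∉ X → c v = 0) : IsDep h X c := by
  unfold IsDep at *
  rw [← hc]
  exact Finset.sum_subset hXY fun v hv hvX => by simp [h0 v hv hvX]

variable [DecidableEq α]

/-- Every nontrivial dependence on `X` is positive at more than `r` elements outside `U`. -/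
def MinPos (h : α → W) (X U : Finset α) (r : ℕ) : Prop :=
  ∀ c : α → ℝ, IsDep h X c → (∃ v ∈ X, c v ≠ 0) → r < ((X.filter (0 < c ·)) \ U).card

lemma MinPos.neg {X U : Finset α} {r : ℕ} (hm : MinPos h X U r) {c : α → ℝ} (hc : IsDep h X c)
    (h0 : ∃ v ∈ X, c v ≠ 0) : r < ((X.filter (c · < 0)) \ U).card := by
  have := hm (-c) hc.neg (by simpa using h0)
  simpa using this

/-- Pairing the dependence with the form defining the face gives a vanishing sum of nonpositive
terms. This is the easy half of the alternative; `faceOn_of_isDep` is the converse. -/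
lemma FaceOn.eq_zero {X A : Finset α} (hA : FaceOn h X A) {c : α → ℝ} (hc : IsDep h X c)
    (hpos : ∀ v ∈ X, 0 < c v → v ∈ A) : ∀ v ∈ X, v ∉ A → c v = 0 := by
  obtain ⟨φ, h0, h1⟩ := hA
  have key := hc.eq_zero_of_nonpos φ (fun v hv => by
    by_cases hvA : v ∈ A
    · simp [h0 v hvA]
    · exact mul_nonpos_of_nonpos_of_nonneg (not_lt.1 fun h => hvA (hpos v hv h)) (h1 v hv hvA).le)
  intro v hv hvA
  exact (mul_eq_zero.1 (key v hv)).resolve_right (h1 v hv hvA).ne'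

/-- Dependences on a subset, extended by zero. -/
lemma IsDep.extend {X Y : Finset α} {c : α → ℝ} (hXY : X ⊆ Y) (hc : IsDep h X c) :
    IsDep h Y (fun v => if v ∈ X then c v else 0) := by
  unfold IsDep at *
  rw [← hc]
  simp only [ite_smul, zero_smul]
  rw [Finset.sum_ite_mem, Finset.inter_eq_right.2 hXY]

/-- Universality implies the lower bound on the positive part of dependences. -/
lemma minPos_of_faceOn {X U : Finset α} {r : ℕ} (hU : U ⊆ X)
    (hind : ∀ c, IsDep h U c → ∀ v ∈ U, c v = 0)
    (hface : ∀ S ⊆ X, S.card ≤ r → FaceOn h X (S ∪ U)) : MinPos h X U r := by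
  intro c hc hne
  by_contra! hcard
  set S := (X.filter (0 < c ·)) \ U with hS
  have hSX : S ⊆ X := Finset.sdiff_subset.trans (Finset.filter_subset _ _)
  -- The face `S ∪ U` kills `c` outside it, so no negative value remains outside `U`. The face `U`,
  -- applied to `-c`, then kills the positive values outside `U` too.
  have h1 := (hface S hSX hcard).eq_zero hc (fun v hv hp => by
    by_cases hvU : v ∈ U
    · exact Finset.mem_union_right _ hvU
    · exact Finset.mem_union_left _ (by simp [hS, hv, hp, hvU]))
  have h2 := (hface ∅ (by simp) (by simp)).eq_zero hc.neg (fun v hv hp => by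
    have hn : c v < 0 := by simpa using hp
    by_contra hvU
    simp only [Finset.empty_union] at hvU
    have hvS : v ∉ S ∪ U := by
      simp [hS, hvU, hn.le]
    exact hn.ne (h1 v hv hvS))
  have h3 : ∀ v ∈ X, v ∉ U → c v = 0 := fun v hv hvU => by simpa using h2 v hv (by simpa using hvU)
  obtain ⟨v, hv, hv0⟩ := hne
  by_cases hvU : v ∈ U
  · exact hv0 (hind c (hc.restrict hU h3) v hvU)
  · exact hv0 (h3 v hv hvU)

/-- Supports of dependences are large when `MinPos` holds. -/
lemma MinPos.eq_zero_of_card {X U Y : Finset α} {r : ℕ} (hm : MinPos h X U r) (hY : Y ⊆ X)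
    (hcard : (Y \ U).card ≤ 2 * r + 1) {c : α → ℝ} (hc : IsDep h Y c) : ∀ v ∈ Y, c v = 0 := by
  by_contra! hne
  obtain ⟨v, hv, hv0⟩ := hne
  set d : α → ℝ := fun v => if v ∈ Y then c v else 0 with hd
  have hdX : IsDep h X d := hc.extend hY
  have hd0 : ∃ v ∈ X, d v ≠ 0 := ⟨v, hY hv, by simpa [hd, hv] using hv0⟩
  -- At least `r + 1` coefficients of each sign would need `2r + 2` places outside `U`.
  have h1 := hm d hdX hd0
  have h2 := hm.neg hdX hd0
  have h3 : (X.filter (0 < d ·)) \ U ∪ (X.filter (d · < 0)) \ U ⊆ Y \ U := by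
    intro w hw
    simp only [Finset.mem_union, Finset.mem_sdiff, Finset.mem_filter] at hw ⊢
    have : w ∈ Y := by
      by_contra hwY
      simp [hd, hwY] at hw
    tauto
  have h4 : Disjoint ((X.filter (0 < d ·)) \ U) ((X.filter (d · < 0)) \ U) := by
    rw [Finset.disjoint_left]
    intro w hw hw'
    simp only [Finset.mem_sdiff, Finset.mem_filter] at hw hw'
    linarith [hw.1.2, hw'.1.2]
  have h5 := Finset.card_le_card h3
  rw [Finset.card_union_of_disjoint h4] at h5
  omega

end Dependences

/-! ### Conformal reduction to minimal support. -/

/-- A vector of a space of functions dominates conformally a vector of minimal support which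
does not vanish at a prescribed place. -/
lemma exists_conformal_minimal {α : Type*} (L : Submodule ℝ (α → ℝ)) (X : Finset α) (j : α)
    (f : α → ℝ) (hf : f ∈ L) (hfj : f j ≠ 0) :
    ∃ g ∈ L, g j ≠ 0 ∧ (∀ v ∈ X, 0 < g v → 0 < f v) ∧ (∀ v ∈ X, g v < 0 → f v < 0) ∧
      ∀ e ∈ L, (∀ v ∈ X, g v = 0 → e v = 0) → e j = 0 → ∀ v ∈ X, e v = 0 := by
  classical
  induction hn : (X.filter (f · ≠ 0)).card using Nat.strong_induction_on generalizing f with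
  | _ n ih =>
  by_cases hmin : ∀ e ∈ L, (∀ v ∈ X, f v = 0 → e v = 0) → e j = 0 → ∀ v ∈ X, e v = 0
  · exact ⟨f, hf, hfj, fun _ _ h => h, fun _ _ h => h, hmin⟩
  push Not at hmin
  obtain ⟨e₀, he₀, hs₀, hj₀, v₀, hv₀, hne₀⟩ := hmin
  obtain ⟨e, he, hs, hj, hpos⟩ : ∃ e ∈ L, (∀ v ∈ X, f v = 0 → e v = 0) ∧ e j = 0 ∧
      0 < f v₀ * e v₀ := by
    have hf0 : f v₀ ≠ 0 := fun h => hne₀ (hs₀ v₀ hv₀ h)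
    rcases lt_or_gt_of_ne (mul_ne_zero hf0 hne₀) with h | h
    · exact ⟨-e₀, L.neg_mem he₀, fun v hv h' => by simp [hs₀ v hv h'], by simp [hj₀],
        by simpa using h⟩
    · exact ⟨e₀, he₀, hs₀, hj₀, h⟩
  -- A ratio test: the least quotient is the largest multiple of `e` that can be subtracted from `f`
  -- without reversing a sign. It creates a new zero at `w` and leaves `f j` alone because `e j =
  -- 0`.
  obtain ⟨w, hw, hwmin⟩ := Finset.exists_min_image (X.filter fun v => 0 < f v * e v)
    (fun v => f v / e v) ⟨v₀, by simp [hv₀, hpos]⟩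
  simp only [Finset.mem_filter, and_imp] at hw hwmin
  set t := f w / e w with ht
  have hew : e w ≠ 0 := fun h => by simp [h] at hw
  have hfw : f w ≠ 0 := fun h => by simp [h] at hw
  have htpos : 0 < t := by
    rcases mul_pos_iff.1 hw.2 with h | h
    · exact div_pos h.1 h.2
    · exact div_pos_of_neg_of_neg h.1 h.2
  set f' : α → ℝ := f - t • e with hf'
  have hf'v : ∀ v, f' v = f v - t * e v := fun v => by simp [hf']
  have hzero : ∀ v ∈ X, f v = 0 → f' v = 0 := fun v hv h => by rw [hf'v, h, hs v hv h]; ring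
  have hP : ∀ v ∈ X, 0 < f v → 0 ≤ f' v := by
    intro v hv h
    rw [hf'v]
    rcases le_or_gt (e v) 0 with h1 | h1
    · nlinarith
    · have := hwmin v hv (mul_pos h h1)
      rw [le_div_iff₀ h1] at this
      linarith
  have hN : ∀ v ∈ X, f v < 0 → f' v ≤ 0 := by
    intro v hv h
    rw [hf'v]
    rcases le_or_gt 0 (e v) with h1 | h1
    · nlinarith
    · have := hwmin v hv (mul_pos_of_neg_of_neg h h1)
      rw [le_div_iff_of_neg h1] at this
      linarith
  have hsub : (X.filter (f' · ≠ 0)) ⊂ X.filter (f · ≠ 0) := by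
    rw [Finset.ssubset_iff_of_subset]
    · refine ⟨w, by simp [hw.1, hfw], ?_⟩
      simp only [Finset.mem_filter, not_and, not_not]
      intro _
      rw [hf'v, ht]
      field_simp
      ring
    · intro v hv
      simp only [Finset.mem_filter] at hv ⊢
      exact ⟨hv.1, fun h => hv.2 (hzero v hv.1 h)⟩
  obtain ⟨g, hg, hgj, hg1, hg2, hg3⟩ := ih _ (hn ▸ Finset.card_lt_card hsub) f'
    (L.sub_mem hf (L.smul_mem _ he)) (by rw [hf'v, hj]; simpa using hfj) rfl
  refine ⟨g, hg, hgj, fun v hv h => ?_, fun v hv h => ?_, hg3⟩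
  · have := hg1 v hv h
    by_contra! hle
    rcases hle.lt_or_eq with h' | h'
    · linarith [hN v hv h']
    · linarith [hzero v hv h']
  · have := hg2 v hv h
    by_contra! hle
    rcases hle.lt_or_eq with h' | h'
    · linarith [hP v hv h']
    · linarith [hzero v hv h'.symm]


/-! ### Theorem of the alternative and existence of facets. -/

section FiniteDimensional

variable {α W : Type*} [NormedAddCommGroup W] [NormedSpace ℝ W] [FiniteDimensional ℝ W]
  {h : α → W}

lemma exists_isDep_of_finrank_lt {X : Finset α} (hX : Module.finrank ℝ W < X.card) :
    ∃ c, IsDep h X c ∧ ∃ v ∈ X, c v ≠ 0 := by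
  classical
  let F : (X → ℝ) →ₗ[ℝ] W := Fintype.linearCombination ℝ fun v : X => h v
  have hker : LinearMap.ker F ≠ ⊥ := LinearMap.ker_ne_bot_of_finrank_lt (by simpa using hX)
  obtain ⟨a, ha, ha0⟩ := (Submodule.ne_bot_iff _).1 hker
  obtain ⟨v, hv⟩ := Function.ne_iff.1 ha0
  refine ⟨fun v => if hv : v ∈ X then a ⟨v, hv⟩ else 0, ?_, v, v.2, by simpa using hv⟩
  have : ∑ v : X, a v • h v = 0 := by
    simpa [F, Fintype.linearCombination_apply] using ha
  rw [IsDep, ← this, ← Finset.sum_coe_sort X]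
  exact Finset.sum_congr rfl fun v _ => by simp

lemma exists_dual_of_card_lt {X : Finset α} (hX : X.card < Module.finrank ℝ W) :
    ∃ φ : W →ₗ[ℝ] ℝ, φ ≠ 0 ∧ ∀ v ∈ X, φ (h v) = 0 := by
  classical
  let F : (W →ₗ[ℝ] ℝ) →ₗ[ℝ] (X → ℝ) := LinearMap.pi fun v => LinearMap.applyₗ (h v)
  have hker : LinearMap.ker F ≠ ⊥ := LinearMap.ker_ne_bot_of_finrank_lt (by
    simpa [Subspace.dual_finrank_eq] using
      hX.trans_eq (Subspace.dual_finrank_eq (K := ℝ) (V := W)).symm)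
  obtain ⟨φ, hφ, hφ0⟩ := (Submodule.ne_bot_iff _).1 hker
  exact ⟨φ, hφ0, fun v hv => congrFun (LinearMap.mem_ker.1 hφ) ⟨v, hv⟩⟩

/-- A form of Gordan's theorem of the alternative. -/
lemma faceOn_of_isDep {X A : Finset α} (hAX : A ⊆ X)
    (hA : ∀ c, IsDep h X c → (∀ v ∈ X, v ∉ A → c v ≤ 0) → ∀ v ∈ X, v ∉ A → c v = 0) :
    FaceOn h X A := by
  classical
  set B := X \ A with hB
  let F : (B → ℝ) →ₗ[ℝ] W := Fintype.linearCombination ℝ fun v : B => h v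
  have hF : ∀ a, F a = ∑ v : B, a v • h v := fun a => by
    simp [F, Fintype.linearCombination_apply]
  let M : Submodule ℝ W := Submodule.span ℝ (h '' A)
  -- A common point of the convex hull of `h '' B` and the span of `h '' A` is a dependence that is
  -- nonpositive, but not zero, off `A`.
  have hdisj : Disjoint (F '' stdSimplex ℝ B) (M : Set W) := by
    rw [Set.disjoint_left]
    rintro _ ⟨a, ha, rfl⟩ haM
    obtain ⟨b, hb⟩ := Submodule.mem_span_image_finset_iff_exists_fun' ℝ |>.1 haM
    set c : α → ℝ := fun v => if hv : v ∈ B then -a ⟨v, hv⟩ else b v with hc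
    have hdep : IsDep h X c := by
      rw [IsDep, ← Finset.sum_sdiff hAX, ← hB]
      have h1 : ∑ v ∈ B, c v • h v = -F a := by
        rw [hF, ← Finset.sum_coe_sort B, ← Finset.sum_neg_distrib]
        exact Finset.sum_congr rfl fun v _ => by simp [hc]
      have h2 : ∑ v ∈ A, c v • h v = F a := by
        rw [← hb]
        exact Finset.sum_congr rfl fun v hv => by simp [hc, hB, hv]
      rw [h1, h2, neg_add_cancel]
    have h0 := hA c hdep fun v hv hvA => by
      have hvB : v ∈ B := by simp [hB, hv, hvA]
      simpa [hc, hvB] using ha.1 ⟨v, hvB⟩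
    have hz : ∀ v : B, a v = 0 := fun v => by
      have hv := v.2
      simp only [hB, Finset.mem_sdiff] at hv
      simpa [hc] using h0 v hv.1 hv.2
    simpa [hz] using ha.2
  obtain ⟨f, s, t, hfs, hst, hft⟩ := geometric_hahn_banach_compact_closed
    ((convex_stdSimplex ℝ B).linear_image F)
    ((isCompact_stdSimplex ℝ B).image F.continuous_of_finiteDimensional)
    M.convex M.closed_of_finiteDimensional hdisj
  have ht0 : t < 0 := by simpa using hft 0 M.zero_mem
  -- A linear form bounded below on a subspace vanishes on it.
  have hM : ∀ p ∈ M, f p = 0 := by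
    intro p hp
    by_contra hne
    have := hft (((t - 1) / f p) • p) (M.smul_mem _ hp)
    rw [map_smul, smul_eq_mul, div_mul_cancel₀ _ hne] at this
    linarith
  refine ⟨-f.toLinearMap, fun v hv => ?_, fun v hv hvA => ?_⟩
  · simpa using hM (h v) (Submodule.subset_span ⟨v, hv, rfl⟩)
  · have hvB : v ∈ B := by simp [hB, hv, hvA]
    have := hfs (h v) ⟨Pi.single ⟨v, hvB⟩ 1, single_mem_stdSimplex ℝ _, by
      simp [F, Fintype.linearCombination_apply_single]⟩
    simp only [LinearMap.neg_apply, Left.neg_pos_iff]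
    exact this.trans (hst.trans ht0)

/-- A nontrivial dependence that is nonpositive off `S ∪ U` has its positive places outside `U`
inside `S`, which is too small. So the alternative applies. -/
lemma MinPos.faceOn [DecidableEq α] {X U S : Finset α} {r : ℕ} (hm : MinPos h X U r) (hU : U ⊆ X)
    (hS : S ⊆ X) (hcard : S.card ≤ r) : FaceOn h X (S ∪ U) := by
  refine faceOn_of_isDep (Finset.union_subset hS hU) fun c hc hle => ?_
  by_contra! hne
  obtain ⟨v, hv, -, hv0⟩ := hne
  have h1 := hm c hc ⟨v, hv, hv0⟩
  have h2 : (X.filter (0 < c ·)) \ U ⊆ S := by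
    intro w hw
    simp only [Finset.mem_sdiff, Finset.mem_filter] at hw
    by_contra hwS
    exact (hle w hw.1.1 (by simp [hwS, hw.2])).not_gt hw.1.2
  exact (h1.trans_le (Finset.card_le_card h2)).not_ge hcard

/-- A face missing `w` is contained in a facet missing `w`. -/
lemma FaceOn.exists_facet {X A : Finset α} (hA : FaceOn h X A) {n : ℕ}
    (hn : Module.finrank ℝ W = n + 1)
    (hspan : ∀ φ : W →ₗ[ℝ] ℝ, (∀ v ∈ X, φ (h v) = 0) → φ = 0) {w : α} (hw : w ∈ X) (hwA : w ∉ A)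
    (hAX : A ⊆ X) :
    ∃ φ : W →ₗ[ℝ] ℝ, (∀ v ∈ X, 0 ≤ φ (h v)) ∧ (∀ v ∈ A, φ (h v) = 0) ∧ 0 < φ (h w) ∧
      n ≤ (X.filter fun v => φ (h v) = 0).card := by
  classical
  obtain ⟨φ₀, h0, h1⟩ := hA
  have hnn : ∀ v ∈ X, 0 ≤ φ₀ (h v) := fun v hv => by
    by_cases hvA : v ∈ A
    · exact (h0 v hvA).ge
    · exact (h1 v hv hvA).le
  let R : (W →ₗ[ℝ] ℝ) →ₗ[ℝ] (α → ℝ) := LinearMap.pi fun v => LinearMap.applyₗ (h v)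
  -- Forms are replaced by their value vectors. Conformality keeps `φ` nonnegative on `X` and zero
  -- on `A`; minimality of support gives many zeros.
  obtain ⟨_, ⟨φ, rfl⟩, hgw, hg1, hg2, hg3⟩ := exists_conformal_minimal (LinearMap.range R) X w
    (R φ₀) ⟨φ₀, rfl⟩ (h1 w hw hwA).ne'
  have hR : ∀ φ v, R φ v = φ (h v) := fun _ _ => rfl
  simp only [hR] at hgw hg1 hg2 hg3
  have hnn' : ∀ v ∈ X, 0 ≤ φ (h v) := fun v hv => by
    by_contra! hlt
    exact (hnn v hv).not_gt (hg2 v hv hlt)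
  refine ⟨φ, hnn', fun v hv => ?_, (hnn' w hw).lt_of_ne' hgw, ?_⟩
  · by_contra hne
    exact (hg1 v (hAX hv) ((hnn' v (hAX hv)).lt_of_ne' hne)).ne' (h0 v hv)
  · by_contra! hlt
    -- With fewer than `n` zeros, adjoining `w` still leaves fewer than `dim W` conditions, so some
    -- nonzero form contradicts minimality.
    obtain ⟨ψ, hψ0, hψ⟩ := exists_dual_of_card_lt (h := h)
      (X := insert w (X.filter fun v => φ (h v) = 0))
      (by rw [hn]; exact (Finset.card_insert_le _ _).trans_lt (by omega))
    refine hψ0 (hspan ψ ?_)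
    exact hg3 (R ψ) ⟨ψ, rfl⟩ (fun v hv hv0 => hψ v (by simp [hv, hv0])) (hψ w (by simp))

end FiniteDimensional

/-! ### Sewing in combinatorial form. -/

/-- The combinatorial data of a neighbourly `2m`-polytope with vertices `V`, a universal tower
`T` in it and a point `z` sewn onto it, in homogeneous coordinates `h`. -/
structure SewingData {α W : Type*} [NormedAddCommGroup W] [NormedSpace ℝ W] [DecidableEq α]
    (h : α → W) (V : Finset α) (z : α) (m : ℕ) (x y : ℕ → α) (T : ℕ → Finset α) : Prop where
  finrank_eq : Module.finrank ℝ W = 2 * m + 1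
  z_notMem : z ∉ V
  lt_card : 2 * m + 1 < V.card
  minPos_empty : MinPos h V ∅ m
  T_zero : T 0 = ∅
  T_succ : ∀ j < m, T (j + 1) = insert (x (j + 1)) (insert (y (j + 1)) (T j))
  x_notMem : ∀ j < m, x (j + 1) ∉ T j
  y_notMem : ∀ j < m, y (j + 1) ∉ T j
  x_ne_y : ∀ j < m, x (j + 1) ≠ y (j + 1)
  T_subset : ∀ j ≤ m, T j ⊆ V
  faceOn : ∀ j ≤ m, ∀ S ⊆ V, S.card ≤ m - j → FaceOn h V (S ∪ T j)
  -- The facet contains `A` and avoids `w`, hence lies in `ℱ_j \ ℱ_{j+1}`. For `j = m` any `w` will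
  -- do because `ℱ_{m+1}` is empty.
  exists_facet : ∀ A ⊆ V, FaceOn h V A → ∀ j ≤ m, T j ⊆ A → ∀ w ∈ V, w ∉ A →
    (j < m → w ∈ T (j + 1)) →
    ∃ φ : W →ₗ[ℝ] ℝ, (∀ v ∈ V, 0 ≤ φ (h v)) ∧ (∀ v ∈ A, φ (h v) = 0) ∧
      (Even j → 0 < φ (h z)) ∧ (Odd j → φ (h z) < 0)

namespace SewingData

variable {α W : Type*} [NormedAddCommGroup W] [NormedSpace ℝ W] [DecidableEq α]
  {h : α → W} {V : Finset α} {z : α} {m : ℕ} {x y : ℕ → α} {T : ℕ → Finset α}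

lemma card_T (D : SewingData h V z m x y T) : ∀ j ≤ m, (T j).card = 2 * j := by
  intro j
  induction j with
  | zero => simp [D.T_zero]
  | succ j ih =>
    intro hj
    have := ih (by omega)
    rw [D.T_succ j hj, Finset.card_insert_of_notMem, Finset.card_insert_of_notMem (D.y_notMem j hj)]
    · omega
    · simp [D.x_ne_y j hj, D.x_notMem j hj]

lemma x_mem (D : SewingData h V z m x y T) {j : ℕ} (hj : j < m) : x (j + 1) ∈ T (j + 1) := by
  simp [D.T_succ j hj]

lemma x_mem_V (D : SewingData h V z m x y T) {j : ℕ} (hj : j < m) : x (j + 1) ∈ V :=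
  D.T_subset _ hj (D.x_mem hj)

/-- Dependences on at most `2m + 1` elements of `V` are trivial. -/
lemma eq_zero_of_card_le (D : SewingData h V z m x y T) {Y : Finset α} (hY : Y ⊆ V)
    (hcard : Y.card ≤ 2 * m + 1) {c : α → ℝ} (hc : IsDep h Y c) : ∀ v ∈ Y, c v = 0 :=
  D.minPos_empty.eq_zero_of_card hY (by simpa using hcard) hc

lemma minPos_of_faceOn (D : SewingData h V z m x y T) {U : Finset α} {r : ℕ} (hU : U ⊆ V)
    (hcard : U.card ≤ 2 * m + 1) (hf : ∀ S ⊆ V, S.card ≤ r → FaceOn h V (S ∪ U)) :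
    MinPos h V U r :=
  SewnPolytope.minPos_of_faceOn hU (fun _ hc => D.eq_zero_of_card_le hU hcard hc) hf

lemma minPos_T (D : SewingData h V z m x y T) {j : ℕ} (hj : j ≤ m) : MinPos h V (T j) (m - j) :=
  D.minPos_of_faceOn (D.T_subset j hj) (by rw [D.card_T j hj]; omega) (D.faceOn j hj)

/-- Some facet containing `A` is on the side of `z` prescribed by the parity of `l`. -/
lemma exists_facet_of_card_le (D : SewingData h V z m x y T) {A : Finset α} (hA : A ⊆ V) {l : ℕ}
    (hl : l ≤ m) (hcard : (A \ T l).card ≤ m - l) :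
    ∃ φ : W →ₗ[ℝ] ℝ, (∀ v ∈ V, 0 ≤ φ (h v)) ∧ (∀ v ∈ A, φ (h v) = 0) ∧
      (Even l → 0 < φ (h z)) ∧ (Odd l → φ (h z) < 0) := by
  induction hn : m - l using Nat.strong_induction_on generalizing l with
  | _ n ih =>
  have hface := D.faceOn l hl (A \ T l) (Finset.sdiff_subset.trans hA) hcard
  rw [Finset.sdiff_union_self_eq_union] at hface
  have hsub : A ∪ T l ⊆ V := Finset.union_subset hA (D.T_subset l hl)
  have facet_of_notMem : ∀ w ∈ V, w ∉ A ∪ T l → (l < m → w ∈ T (l + 1)) →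
      ∃ φ : W →ₗ[ℝ] ℝ, (∀ v ∈ V, 0 ≤ φ (h v)) ∧ (∀ v ∈ A, φ (h v) = 0) ∧
      (Even l → 0 < φ (h z)) ∧ (Odd l → φ (h z) < 0) := fun w hw hwA hwT => by
    obtain ⟨φ, h1, h2, h3, h4⟩ := D.exists_facet _ hsub hface l hl Finset.subset_union_right w hw
      hwA hwT
    exact ⟨φ, h1, fun v hv => h2 v (Finset.mem_union_left _ hv), h3, h4⟩
  rcases hl.lt_or_eq with hlt | rfl
  · by_cases hT : T (l + 1) ⊆ A ∪ T l
    -- Here `A` spends two of its `m - l` points on `x (l + 1)` and `y (l + 1)`, so passing to `l +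
    -- 2` preserves both the parity and the bound.
    · have hTT : T (l + 1) = insert (x (l + 1)) (insert (y (l + 1)) (T l)) := D.T_succ l hlt
      have hxA : x (l + 1) ∈ A \ T l := by
        have := hT (D.x_mem hlt)
        simpa [D.x_notMem l hlt] using this
      have hyA : y (l + 1) ∈ A \ T l := by
        have := hT (show y (l + 1) ∈ T (l + 1) by simp [hTT])
        simpa [D.y_notMem l hlt] using this
      have h1 : A \ T (l + 1) = ((A \ T l).erase (x (l + 1))).erase (y (l + 1)) := by
        ext v
        simp only [hTT, Finset.mem_sdiff, Finset.mem_insert, Finset.mem_erase]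
        tauto
      have h2 : (A \ T (l + 1)).card + 2 = (A \ T l).card := by
        have hyA' : y (l + 1) ∈ (A \ T l).erase (x (l + 1)) :=
          Finset.mem_erase.2 ⟨(D.x_ne_y l hlt).symm, hyA⟩
        rw [h1, Finset.card_erase_of_mem hyA', Finset.card_erase_of_mem hxA]
        have : 0 < ((A \ T l).erase (x (l + 1))).card := Finset.card_pos.2 ⟨_, hyA'⟩
        rw [Finset.card_erase_of_mem hxA] at this
        omega
      have hl2 : l + 2 ≤ m := by omega
      have h3 : (A \ T (l + 2)).card ≤ (A \ T (l + 1)).card := by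
        refine Finset.card_le_card (Finset.sdiff_subset_sdiff subset_rfl ?_)
        rw [D.T_succ (l + 1) hl2]
        exact (Finset.subset_insert _ _).trans (Finset.subset_insert _ _)
      obtain ⟨φ, p1, p2, p3, p4⟩ := ih (m - (l + 2)) (by omega) hl2 (by omega) rfl
      exact ⟨φ, p1, p2, fun he => p3 (by simpa [parity_simps] using he),
        fun ho => p4 (by simpa [parity_simps] using ho)⟩
    · obtain ⟨w, hw, hwA⟩ := Finset.not_subset.1 hT
      exact facet_of_notMem w (D.T_subset _ hlt hw) hwA fun _ => hw
  -- At the top of the tower `A` lies in `T m`, which has only `2m` elements, so any remaining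
  -- vertex can be avoided.
  · have h0 : A \ T l = ∅ := by simpa using hcard
    have hlt : (A ∪ T l).card < V.card := by
      rw [← Finset.sdiff_union_self_eq_union, h0, Finset.empty_union, D.card_T l le_rfl]
      have := D.lt_card
      omega
    obtain ⟨w, hw, hwA⟩ := Finset.exists_mem_notMem_of_card_lt_card hlt
    exact facet_of_notMem w hw hwA fun h => absurd h (lt_irrefl _)

/-- A set that is small outside `T i ∪ {x (i + 1)}` is contained in facets of both kinds. -/
lemma exists_facets (D : SewingData h V z m x y T) {A : Finset α} (hA : A ⊆ V) {i : ℕ} (hi : i < m)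
    (hcard : (A \ insert (x (i + 1)) (T i)).card ≤ m - i - 1) :
    (∃ φ : W →ₗ[ℝ] ℝ, (∀ v ∈ V, 0 ≤ φ (h v)) ∧ (∀ v ∈ A, φ (h v) = 0) ∧ 0 < φ (h z)) ∧
    ∃ φ : W →ₗ[ℝ] ℝ, (∀ v ∈ V, 0 ≤ φ (h v)) ∧ (∀ v ∈ A, φ (h v) = 0) ∧ φ (h z) < 0 := by
  have h1 : (A \ T i).card ≤ m - i := by
    have : A \ T i ⊆ insert (x (i + 1)) (A \ insert (x (i + 1)) (T i)) := by
      intro v hv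
      simp only [Finset.mem_insert, Finset.mem_sdiff] at hv ⊢
      tauto
    have := (Finset.card_le_card this).trans (Finset.card_insert_le _ _)
    omega
  have h2 : (A \ T (i + 1)).card ≤ m - (i + 1) := by
    refine (Finset.card_le_card (Finset.sdiff_subset_sdiff subset_rfl ?_)).trans
      (hcard.trans (by omega))
    rw [D.T_succ i hi]
    exact Finset.insert_subset_insert _ (Finset.subset_insert _ _)
  obtain ⟨φ, p1, p2, p3, p4⟩ := D.exists_facet_of_card_le hA hi.le h1
  obtain ⟨ψ, q1, q2, q3, q4⟩ := D.exists_facet_of_card_le hA hi h2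
  rcases Nat.even_or_odd i with he | ho
  · exact ⟨⟨φ, p1, p2, p3 he⟩, ψ, q1, q2, q4 he.add_one⟩
  · exact ⟨⟨ψ, q1, q2, q3 ho.add_one⟩, φ, p1, p2, p4 ho⟩

/-- `T i ∪ {x (i + 1), z}` is universal after sewing. -/
lemma minPos_sewn (D : SewingData h V z m x y T) {i : ℕ} (hi : i < m) :
    MinPos h (insert z V) (insert z (insert (x (i + 1)) (T i))) (m - i - 1) := by
  intro c hc hne
  by_contra! hcard
  set B := insert z (insert (x (i + 1)) (T i)) with hB
  set S := ((insert z V).filter (0 < c ·)) \ B with hS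
  have hSV : S ⊆ V := by
    intro v hv
    simp only [hS, hB, Finset.mem_sdiff, Finset.mem_filter, Finset.mem_insert] at hv
    tauto
  set A := S ∪ insert (x (i + 1)) (T i) with hA
  have hAV : A ⊆ V := Finset.union_subset hSV
    (Finset.insert_subset (D.x_mem_V hi) (D.T_subset i hi.le))
  have hcard' : (A \ insert (x (i + 1)) (T i)).card ≤ m - i - 1 := by
    rw [hA, Finset.union_sdiff_right]
    exact (Finset.card_le_card Finset.sdiff_subset).trans hcard
  obtain ⟨⟨φ, p1, p2, p3⟩, ψ, q1, q2, q3⟩ := D.exists_facets hAV hi hcard'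
  have hout : ∀ v ∈ V, v ∉ A → c v ≤ 0 := by
    intro v hv hvA
    by_contra! hlt
    refine hvA ?_
    by_cases hvB : v ∈ insert (x (i + 1)) (T i)
    · exact Finset.mem_union_right _ hvB
    · have hvz : v ≠ z := fun h => D.z_notMem (h ▸ hv)
      refine Finset.mem_union_left _ ?_
      simp only [hS, hB, Finset.mem_sdiff, Finset.mem_filter]
      refine ⟨⟨Finset.mem_insert_of_mem hv, hlt⟩, ?_⟩
      rw [Finset.mem_insert]
      exact fun h => h.elim hvz hvB
  -- Facets through `A` exist with `z` on either side. Whatever the sign of `c z`, one of them makes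
  -- all terms nonpositive and forces `c z = 0`.
  have side : ∀ θ : W →ₗ[ℝ] ℝ, (∀ v ∈ V, 0 ≤ θ (h v)) → (∀ v ∈ A, θ (h v) = 0) →
      c z * θ (h z) ≤ 0 → c z * θ (h z) = 0 := fun θ t1 t2 t3 =>
    hc.eq_zero_of_nonpos θ (fun v hv => by
      rcases Finset.mem_insert.1 hv with rfl | hv
      · exact t3
      · by_cases hvA : v ∈ A
        · simp [t2 v hvA]
        · exact mul_nonpos_of_nonpos_of_nonneg (hout v hv hvA) (t1 v hv)) z (by simp)
  have hcz : c z = 0 := by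
    rcases le_total (c z) 0 with hle | hle
    · exact (mul_eq_zero.1 (side φ p1 p2 (by nlinarith))).resolve_right p3.ne'
    · exact (mul_eq_zero.1 (side ψ q1 q2 (by nlinarith))).resolve_right q3.ne
  have hcV : IsDep h V c := hc.restrict (Finset.subset_insert _ _) fun v hv hvV => by
    rw [(Finset.mem_insert.1 hv).resolve_right hvV, hcz]
  obtain ⟨v, hv, hv0⟩ := hne
  have hvV : v ∈ V := (Finset.mem_insert.1 hv).resolve_left fun h => hv0 (h ▸ hcz)
  -- Now `c` lives on `V`, where `T i` is universal; discarding `x (i + 1)` costs at most one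
  -- positive place.
  have hlt := D.minPos_T hi.le c hcV ⟨v, hvV, hv0⟩
  have hsub : (V.filter (0 < c ·)) \ T i ⊆ insert (x (i + 1)) S := by
    intro w hw
    simp only [Finset.mem_sdiff, Finset.mem_filter] at hw
    have hwz : w ≠ z := fun h => D.z_notMem (h ▸ hw.1.1)
    simp only [hS, hB, Finset.mem_insert, Finset.mem_sdiff, Finset.mem_filter]
    tauto
  have := (Finset.card_le_card hsub).trans (Finset.card_insert_le _ _)
  omega

/-- In the quotient by `T i` the point `z` is close to `x (i + 1)` if `i` is even, and to its
negative if `i` is odd. -/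
lemma lt_card_neg (D : SewingData h V z m x y T) {i : ℕ} (hi : i < m) {c : α → ℝ}
    (hc : IsDep h (insert z V) c) (hx : 0 ≤ c (x (i + 1)))
    (hz : (Even i ∧ 0 < c z) ∨ (Odd i ∧ c z < 0)) :
    m - i < ((V.filter (c · < 0)) \ T i).card := by
  by_contra! hcard
  set S := (V.filter (c · < 0)) \ T i with hS
  have hSV : S ⊆ V := Finset.sdiff_subset.trans (Finset.filter_subset _ _)
  have hxS : x (i + 1) ∉ S ∪ T i := by
    simp [hS, D.x_notMem i hi, hx]
  -- A facet through all negative places and `T i`, avoiding `x (i + 1)`: every term of the pairing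
  -- is nonnegative, and the one at `z` is positive.
  obtain ⟨φ, p1, p2, p3, p4⟩ := D.exists_facet _
    (Finset.union_subset hSV (D.T_subset i hi.le)) (D.faceOn i hi.le S hSV hcard) i hi.le
    Finset.subset_union_right _ (D.x_mem_V hi) hxS fun _ => D.x_mem hi
  have hzφ : 0 < c z * φ (h z) := by
    rcases hz with ⟨he, hp⟩ | ⟨ho, hn⟩
    · exact mul_pos hp (p3 he)
    · exact mul_pos_of_neg_of_neg hn (p4 ho)
  have key := hc.neg.eq_zero_of_nonpos φ (fun v hv => by
    rcases Finset.mem_insert.1 hv with rfl | hv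
    · simpa using hzφ.le
    · by_cases hvA : v ∈ S ∪ T i
      · simp [p2 v hvA]
      · have : 0 ≤ c v := by
          by_contra! hlt
          simp [hS, hv, hlt] at hvA
        simpa using mul_nonneg this (p1 v hv)) z (by simp)
  simp only [Pi.neg_apply, neg_mul, neg_eq_zero] at key
  exact hzφ.ne' key

/-- If `x (i + 1)` is not an element of the universal set `U ⊇ T i` and `i` is even, then
universality of `U ∪ {x (i + 1), z}` after sewing implies that of `U`. -/
lemma minPos_of_minPos_insert (D : SewingData h V z m x y T) {i k : ℕ} (hik : i < k) (hkm : k < m)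
    {U : Finset α} (hU : U ⊆ V) (hcard : U.card = 2 * k) (hTU : T i ⊆ U) (hxU : x (i + 1) ∉ U)
    (hf : ∀ S ⊆ V, S.card ≤ m - k → FaceOn h V (S ∪ U)) (hi : Even i)
    (hm : MinPos h (insert z V) (insert z (insert (x (i + 1)) U)) (m - k - 1)) :
    MinPos h (insert z V) U (m - k) := by
  have him : i < m := hik.trans hkm
  intro c hc hne
  by_contra! hle
  have hW := hm c hc hne
  set x' := x (i + 1) with hx'
  set Q := (insert z V).filter (0 < c ·) with hQ
  -- If `z` or `x'` were among the at most `m - k` positive places outside `U`, at most `m - k - 1`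
  -- would remain outside `U ∪ {x', z}`.
  have hno : ∀ w ∈ Q \ U, w ≠ z ∧ w ≠ x' := by
    by_contra! hw
    obtain ⟨w, hw, hwz⟩ := hw
    have hsub : Q \ insert z (insert x' U) ⊆ (Q \ U).erase w := by
      intro v hv
      simp only [Finset.mem_sdiff, Finset.mem_insert, not_or, Finset.mem_erase] at hv ⊢
      refine ⟨fun h => ?_, hv.1, hv.2.2.2⟩
      by_cases hz : w = z
      · exact hv.2.1 (h.trans hz)
      · exact hv.2.2.1 (h.trans (hwz hz))
    have := Finset.card_le_card hsub
    rw [Finset.card_erase_of_mem hw] at this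
    omega
  have hzU : z ∉ U := fun hz => D.z_notMem (hU hz)
  have hcz : c z ≤ 0 := by
    by_contra! hlt
    exact (hno z (by simp [hQ, hlt, hzU])).1 rfl
  have hcx : c x' ≤ 0 := by
    by_contra! hlt
    have hxV : x' ∈ V := D.x_mem_V him
    exact (hno x' (by simp [hQ, hlt, hxU, hxV])).2 rfl
  have hSV : Q \ U ⊆ V := by
    intro v hv
    have := (hno v hv).1
    simp only [hQ, Finset.mem_sdiff, Finset.mem_filter, Finset.mem_insert] at hv
    tauto
  have hxS : x' ∉ Q \ U ∪ U := by
    simp [hQ, hxU, hcx]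
  -- As `i` is even, `z` is beneath this facet, which avoids `x'`; together with `c z ≤ 0` this
  -- makes every term nonpositive.
  obtain ⟨φ, p1, p2, p3, -⟩ := D.exists_facet _ (Finset.union_subset hSV hU) (hf _ hSV hle) i him.le
    (hTU.trans Finset.subset_union_right) x' (D.x_mem_V him) hxS fun _ => D.x_mem him
  have key := hc.eq_zero_of_nonpos φ (fun v hv => by
    rcases Finset.mem_insert.1 hv with rfl | hvV
    · exact mul_nonpos_of_nonpos_of_nonneg hcz (p3 hi).le
    · by_cases hvA : v ∈ Q \ U ∪ U
      · simp [p2 v hvA]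
      · refine mul_nonpos_of_nonpos_of_nonneg ?_ (p1 v hvV)
        by_contra! hlt
        simp only [Finset.sdiff_union_self_eq_union, Finset.mem_union, not_or] at hvA
        exact hvA.1 (by simp [hQ, hvV, hlt])) z (by simp)
  have hcz0 : c z = 0 := (mul_eq_zero.1 key).resolve_right (p3 hi).ne'
  have hcV : IsDep h V c := hc.restrict (Finset.subset_insert _ _) fun v hv hvV => by
    rw [(Finset.mem_insert.1 hv).resolve_right hvV, hcz0]
  obtain ⟨v, hv, hv0⟩ := hne
  have hvV : v ∈ V := (Finset.mem_insert.1 hv).resolve_left fun h => hv0 (h ▸ hcz0)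
  have hlt := D.minPos_of_faceOn hU (by omega) hf c hcV ⟨v, hvV, hv0⟩
  refine (hlt.trans_le (Finset.card_le_card ?_)).not_ge hle
  exact Finset.sdiff_subset_sdiff (Finset.filter_subset_filter _ (Finset.subset_insert _ _))
    subset_rfl

/-- If the universal set `U ⊇ T i` not containing `x (i + 1)` remains universal after sewing, then
`i` is even. -/
lemma even_of_minPos [FiniteDimensional ℝ W] (D : SewingData h V z m x y T) {i k : ℕ} (hik : i < k)
    (hkm : k < m) {U : Finset α} (hU : U ⊆ V) (hcard : U.card = 2 * k) (hTU : T i ⊆ U)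
    (hxU : x (i + 1) ∉ U) (hf : ∀ S ⊆ V, S.card ≤ m - k → FaceOn h V (S ∪ U))
    (hm : MinPos h (insert z V) U (m - k)) : Even i := by
  by_contra hi
  rw [Nat.not_even_iff_odd] at hi
  have him : i < m := hik.trans hkm
  set x' := x (i + 1) with hx'
  have hxV : x' ∈ V := D.x_mem_V him
  -- By neighbourliness `2m + 1` vertices are independent, so `Y` gives a basis of `W` containing
  -- `U` and avoiding `x'`.
  obtain ⟨Y, hUY, hYV, hYcard⟩ : ∃ Y, U ⊆ Y ∧ Y ⊆ V.erase x' ∧ Y.card = 2 * m + 1 := by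
    refine Finset.exists_subsuperset_card_eq (fun v hv => ?_) (by omega) ?_
    · exact Finset.mem_erase.2 ⟨fun h => hxU (h ▸ hv), hU hv⟩
    · rw [Finset.card_erase_of_mem hxV]
      have := D.lt_card
      omega
  have hYV' : Y ⊆ V := hYV.trans (Finset.erase_subset _ _)
  have hxY : x' ∉ Y := fun h => (Finset.mem_erase.1 (hYV h)).1 rfl
  have hzV := D.z_notMem
  have hzY : z ∉ Y := fun h => hzV (hYV' h)
  have hxz : x' ≠ z := fun h => hzV (h ▸ hxV)
  -- a dependence involving `w` and elements of `Y` only, with coefficient `-1` at `w`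
  have exists_rep : ∀ w ∉ Y, ∃ c : α → ℝ, IsDep h (insert w Y) c ∧ c w = -1 := by
    intro w hw
    obtain ⟨c, hc, hne⟩ := exists_isDep_of_finrank_lt (h := h) (X := insert w Y) (by
      rw [D.finrank_eq, Finset.card_insert_of_notMem hw]; omega)
    have hcw : c w ≠ 0 := by
      intro h0
      have h1 := D.eq_zero_of_card_le hYV' hYcard.le
        (hc.restrict (Finset.subset_insert _ _) fun v hv hvY => by
          rw [(Finset.mem_insert.1 hv).resolve_right hvY, h0])
      obtain ⟨v, hv, hv0⟩ := hne
      rcases Finset.mem_insert.1 hv with rfl | hv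
      · exact hv0 h0
      · exact hv0 (h1 v hv)
    refine ⟨fun v => (-(c w)⁻¹) * c v, ?_, by field_simp⟩
    unfold IsDep at hc ⊢
    simp only [mul_smul, ← Finset.smul_sum, hc, smul_zero]
  obtain ⟨b, hb, hbz⟩ := exists_rep z hzY
  obtain ⟨d, hd, hdx⟩ := exists_rep x' hxY
  have hYz : insert z Y ⊆ insert z V := Finset.insert_subset_insert _ hYV'
  have hYx : insert x' Y ⊆ V := Finset.insert_subset hxV hYV'
  have hVz : V ⊆ insert z V := Finset.subset_insert _ _
  -- both dependences extended by zero
  set b' : α → ℝ := fun v => if v ∈ insert z Y then b v else 0 with hb'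
  set d' : α → ℝ := fun v => if v ∈ insert x' Y then d v else 0 with hd'
  have hb'dep : IsDep h (insert z V) b' := hb.extend hYz
  have hd'depV : IsDep h V d' := hd.extend hYx
  have hd'dep : IsDep h (insert z V) d' := hd.extend (hYx.trans hVz)
  have hb'z : b' z = -1 := by simp [hb', hbz]
  have hd'x : d' x' = -1 := by simp [hd', hdx]
  have hb'x : b' x' = 0 := by simp [hb', hxY, hxz]
  have hd'z : d' z = 0 := by simp [hd', hzY, hxz.symm]
  have cb := hm b' hb'dep ⟨z, by simp, by simp [hb'z]⟩
  have cd := D.minPos_of_faceOn hU (by omega) hf d' hd'depV ⟨x', hxV, by simp [hd'x]⟩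
  have sb : ((insert z V).filter (0 < b' ·)) \ U ⊆ (Y \ U).filter (0 < b' ·) := by
    intro v hv
    simp only [Finset.mem_sdiff, Finset.mem_filter] at hv ⊢
    refine ⟨⟨?_, hv.2⟩, hv.1.2⟩
    by_contra hvY
    have hp := hv.1.2
    by_cases hvz : v = z
    · rw [hvz, hb'z] at hp; linarith
    · simp [hb', hvY, hvz] at hp
  have sd : (V.filter (0 < d' ·)) \ U ⊆ (Y \ U).filter (0 < d' ·) := by
    intro v hv
    simp only [Finset.mem_sdiff, Finset.mem_filter] at hv ⊢
    refine ⟨⟨?_, hv.2⟩, hv.1.2⟩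
    by_contra hvY
    have hp := hv.1.2
    by_cases hvx : v = x'
    · rw [hvx, hd'x] at hp; linarith
    · simp [hd', hvY, hvx] at hp
  have hYU : (Y \ U).card = 2 * m + 1 - 2 * k := by
    rw [Finset.card_sdiff_of_subset hUY, hYcard, hcard]
  -- Each positive set has at least `m - k + 1` elements, while `Y \ U` has only `2(m - k) + 1`.
  obtain ⟨t, ht⟩ : ((Y \ U).filter (0 < b' ·) ∩ (Y \ U).filter (0 < d' ·)).Nonempty := by
    rw [← Finset.card_pos]
    have h1 := Finset.card_union_add_card_inter ((Y \ U).filter (0 < b' ·))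
      ((Y \ U).filter (0 < d' ·))
    have h2 : ((Y \ U).filter (0 < b' ·) ∪ (Y \ U).filter (0 < d' ·)).card ≤ (Y \ U).card :=
      Finset.card_le_card (Finset.union_subset (Finset.filter_subset _ _)
        (Finset.filter_subset _ _))
    have h3 := Finset.card_le_card sb
    have h4 := Finset.card_le_card sd
    omega
  simp only [Finset.mem_inter, Finset.mem_filter, Finset.mem_sdiff] at ht
  obtain ⟨⟨⟨htY, htU⟩, htb⟩, -, htd⟩ := ht
  -- This multiple cancels the coefficient at `t` and leaves `-1` at `z` and `s > 0` at `x'`, the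
  -- signs `lt_card_neg` needs for odd `i`.
  set s := b' t / d' t with hs
  have hspos : 0 < s := div_pos htb htd
  set e : α → ℝ := fun v => b' v + (-s) * d' v with he
  have hedep : IsDep h (insert z V) e := hb'dep.add_const_mul hd'dep (-s)
  have hez : e z = -1 := by simp [he, hb'z, hd'z]
  have hex : e x' = s := by simp [he, hb'x, hd'x]
  have het : e t = 0 := by
    simp only [he, hs]
    field_simp
    ring
  have heY : ∀ v, e v ≠ 0 → v ∈ Y ∨ v = z ∨ v = x' := by
    intro v hv
    by_contra! hcon
    exact hv (by simp [he, hb', hd', hcon])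
  have c1 := D.lt_card_neg him hedep (hex.symm ▸ hspos.le) (Or.inr ⟨hi, by rw [hez]; norm_num⟩)
  have c2 := D.minPos_sewn him e hedep ⟨z, by simp, by simp [hez]⟩
  rw [← hx'] at c2
  have hdisj : Disjoint ((V.filter (e · < 0)) \ T i)
      (((insert z V).filter (0 < e ·)) \ insert z (insert x' (T i))) := by
    rw [Finset.disjoint_left]
    intro w hw hw'
    simp only [Finset.mem_sdiff, Finset.mem_filter] at hw hw'
    linarith [hw.1.2, hw'.1.2]
  have hsub : ((V.filter (e · < 0)) \ T i) ∪
      (((insert z V).filter (0 < e ·)) \ insert z (insert x' (T i))) ⊆ (Y \ T i).erase t := by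
    intro w hw
    simp only [Finset.mem_union, Finset.mem_sdiff, Finset.mem_filter, Finset.mem_insert,
      not_or] at hw
    rw [Finset.mem_erase, Finset.mem_sdiff]
    rcases hw with ⟨⟨hwV, hw⟩, hwT⟩ | ⟨⟨-, hw⟩, hwz, hwx, hwT⟩
    · refine ⟨fun h => by rw [h, het] at hw; exact lt_irrefl _ hw, ?_, hwT⟩
      rcases heY w hw.ne with h | rfl | rfl
      · exact h
      · exact absurd hwV hzV
      · rw [hex] at hw; exact absurd hw hspos.not_gt
    · refine ⟨fun h => by rw [h, het] at hw; exact lt_irrefl _ hw, ?_, hwT⟩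
      exact (heY w hw.ne').resolve_right fun h => h.elim hwz hwx
  -- At least `2m - 2i + 1` signed places lie in `Y \ T i` without `t`, a set of `2m - 2i` elements.
  have hle := Finset.card_le_card hsub
  rw [Finset.card_union_of_disjoint hdisj, Finset.card_erase_of_mem
    (Finset.mem_sdiff.2 ⟨htY, fun h => htU (hTU h)⟩),
    Finset.card_sdiff_of_subset (hTU.trans hUY), hYcard, D.card_T i him.le] at hle
  omega

/-- If `i` is even and `U ⊇ T i`, not containing `x (i + 1)`, is universal after sewing, then so is
`U ∪ {x (i + 1), z}`. -/
lemma minPos_insert_of_minPos [FiniteDimensional ℝ W] (D : SewingData h V z m x y T) {i k : ℕ}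
    (hik : i < k) (hkm : k < m) {U : Finset α} (hU : U ⊆ V) (hcard : U.card = 2 * k)
    (hTU : T i ⊆ U) (hxU : x (i + 1) ∉ U) (hi : Even i)
    (hm : MinPos h (insert z V) U (m - k)) :
    MinPos h (insert z V) (insert z (insert (x (i + 1)) U)) (m - k - 1) := by
  intro c hc hne
  by_contra! hle
  have him : i < m := hik.trans hkm
  set x' := x (i + 1) with hx'
  have hxV : x' ∈ V := D.x_mem_V him
  have hzV := D.z_notMem
  have hxz : x' ≠ z := fun h => hzV (h ▸ hxV)
  have hzU : z ∉ U := fun h => hzV (hU h)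
  have hUz : U ⊆ insert z V := hU.trans (Finset.subset_insert _ _)
  -- If `z` or `x'` is not positive, at most `(m - k - 1) + 1` positive places remain outside `U`,
  -- contradicting universality of `U`. The bound depends only on where `c` is positive, so it
  -- passes to `g`.
  have both : ∀ g : α → ℝ, IsDep h (insert z V) g → (∃ v ∈ insert z V, g v ≠ 0) →
      (∀ v ∈ insert z V \ U, 0 < g v → 0 < c v) → 0 < g z ∧ 0 < g x' := by
    intro g hg hg0 hgc
    have h1 := hm g hg hg0
    set R := ((insert z V).filter (0 < c ·)) \ insert z (insert x' U) with hR
    have hsub : ∀ w, (w = z ∨ w = x') → ¬ 0 < g w →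
        ((insert z V).filter (0 < g ·)) \ U ⊆ insert (if w = z then x' else z) R := by
      intro w hw hgw v hv
      simp only [Finset.mem_sdiff, Finset.mem_filter] at hv
      have hvc := hgc v (Finset.mem_sdiff.2 ⟨hv.1.1, hv.2⟩) hv.1.2
      have hvw : v ≠ w := fun h => hgw (h ▸ hv.1.2)
      rw [Finset.mem_insert]
      by_cases hvz : v = z
      · left
        rw [if_neg fun h => hvw (hvz.trans h.symm), hvz]
      · by_cases hvx : v = x'
        · left
          rw [if_pos (hw.resolve_right fun h => hvw (hvx.trans h.symm)), hvx]
        · right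
          simp only [hR, Finset.mem_sdiff, Finset.mem_filter, Finset.mem_insert, not_or]
          exact ⟨⟨by simpa using hv.1.1, hvc⟩, hvz, hvx, hv.2⟩
    constructor
    · by_contra hcon
      have := (Finset.card_le_card (hsub z (Or.inl rfl) hcon)).trans (Finset.card_insert_le _ _)
      omega
    · by_contra hcon
      have := (Finset.card_le_card (hsub x' (Or.inr rfl) hcon)).trans (Finset.card_insert_le _ _)
      omega
  obtain ⟨hcz, -⟩ := both c hc hne fun _ _ h => h
  let L : Submodule ℝ (α → ℝ) :=
    { carrier := {g | IsDep h (insert z V) g}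
      add_mem' := fun {a b} ha hb => by
        have := IsDep.add_const_mul ha hb 1
        simp only [one_mul] at this
        exact this
      zero_mem' := by simp [IsDep]
      smul_mem' := fun r a ha => by
        have h0 : IsDep h (insert z V) (0 : α → ℝ) := by simp [IsDep]
        have := IsDep.add_const_mul h0 ha r
        simp only [Pi.zero_apply, zero_add] at this
        exact this }
  -- Signs and support are controlled only outside `U`, so `g` is in effect a circuit modulo `U`.
  obtain ⟨g, hg, hgz, hg1, -, hg3⟩ :=
    exists_conformal_minimal L (insert z V \ U) z c hc hcz.ne'
  obtain ⟨hgz, hgx⟩ := both g hg ⟨z, by simp, hgz⟩ hg1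
  set R := (insert z V \ U).filter (g · ≠ 0) with hR
  have hzR : z ∈ R := by simp [hR, hzU, hgz.ne']
  have hxR : x' ∈ R := by simp [hR, hxU, hgx.ne', hxV]
  have hRU : Disjoint R U := by
    rw [Finset.disjoint_left]
    intro v hv
    simp only [hR, Finset.mem_filter, Finset.mem_sdiff] at hv
    exact hv.1.2
  -- Otherwise `R ∪ U` without `z` exceeds the dimension and carries a dependence vanishing at `z`.
  -- Minimality of `g` confines that dependence to the independent set `U`.
  have hRcard : R.card + 2 * k ≤ 2 * m + 2 := by
    by_contra! hlt
    have hsubY : (R ∪ U).erase z ⊆ insert z V := by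
      refine (Finset.erase_subset _ _).trans (Finset.union_subset ?_ hUz)
      exact (Finset.filter_subset _ _).trans Finset.sdiff_subset
    obtain ⟨e, he, v, hv, hv0⟩ := exists_isDep_of_finrank_lt (h := h) (X := (R ∪ U).erase z) (by
      rw [D.finrank_eq, Finset.card_erase_of_mem (Finset.mem_union_left _ hzR),
        Finset.card_union_of_disjoint hRU]
      omega)
    set e' : α → ℝ := fun v => if v ∈ (R ∪ U).erase z then e v else 0 with he'
    have h0 := hg3 e' (he.extend hsubY) (fun w hw hgw => by
      have : w ∉ R ∪ U := by
        simp only [Finset.mem_sdiff] at hw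
        simp [hR, hgw, hw.2]
      exact if_neg fun h => this (Finset.mem_of_mem_erase h)) (by simp [he'])
    have h1 : ∀ w ∈ (R ∪ U).erase z, w ∉ U → e w = 0 := fun w hw hwU => by
      have := h0 w (Finset.mem_sdiff.2 ⟨hsubY hw, hwU⟩)
      simp only [he', if_pos hw] at this
      exact this
    have hUsub : U ⊆ (R ∪ U).erase z := fun w hw =>
      Finset.mem_erase.2 ⟨fun h => hzU (h ▸ hw), Finset.mem_union_right _ hw⟩
    have h2 := D.eq_zero_of_card_le hU (by omega) (he.restrict hUsub h1)
    by_cases hvU : v ∈ U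
    · exact hv0 (h2 v hvU)
    · exact hv0 (h1 v hv hvU)
  have c1 := D.lt_card_neg him hg hgx.le (Or.inl ⟨hi, hgz⟩)
  have c2 := D.minPos_sewn him g hg ⟨z, by simp, hgz.ne'⟩
  rw [← hx'] at c2
  have hdisj : Disjoint ((V.filter (g · < 0)) \ T i)
      (((insert z V).filter (0 < g ·)) \ insert z (insert x' (T i))) := by
    rw [Finset.disjoint_left]
    intro w hw hw'
    simp only [Finset.mem_sdiff, Finset.mem_filter] at hw hw'
    linarith [hw.1.2, hw'.1.2]
  have hsub : ((V.filter (g · < 0)) \ T i) ∪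
      (((insert z V).filter (0 < g ·)) \ insert z (insert x' (T i))) ⊆
      ((R.erase z).erase x') ∪ (U \ T i) := by
    intro w hw
    have hw' : w ∈ insert z V ∧ g w ≠ 0 ∧ w ≠ z ∧ w ≠ x' ∧ w ∉ T i := by
      simp only [Finset.mem_union, Finset.mem_sdiff, Finset.mem_filter, Finset.mem_insert,
        not_or] at hw ⊢
      rcases hw with ⟨⟨hwV, hw⟩, hwT⟩ | ⟨⟨hwV, hw⟩, hwz, hwx, hwT⟩
      · exact ⟨Or.inr hwV, hw.ne, fun h => hzV (h ▸ hwV),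
          fun h => hgx.not_gt (h ▸ hw), hwT⟩
      · exact ⟨hwV, hw.ne', hwz, hwx, hwT⟩
    simp only [Finset.mem_union, Finset.mem_erase, hR, Finset.mem_filter, Finset.mem_sdiff]
    tauto
  -- At least `2m - 2i + 1` signed places would fit into at most `(2m - 2k) + (2k - 2i)`.
  have hcle := (Finset.card_le_card hsub).trans (Finset.card_union_le _ _)
  rw [Finset.card_union_of_disjoint hdisj, Finset.card_erase_of_mem
    (Finset.mem_erase.2 ⟨hxz, hxR⟩), Finset.card_erase_of_mem hzR,
    Finset.card_sdiff_of_subset hTU, hcard, D.card_T i him.le] at hcle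
  have h2R : 1 < R.card := Finset.one_lt_card.2 ⟨z, hzR, x', hxR, hxz.symm⟩
  omega

/-- `U ∪ {x (i + 1), z}` is independent. -/
lemma eq_zero_of_insert (D : SewingData h V z m x y T) {i k : ℕ} (hik : i < k) (hkm : k < m)
    {U : Finset α} (hU : U ⊆ V) (hcard : U.card = 2 * k) (hTU : T i ⊆ U) (c : α → ℝ)
    (hc : IsDep h (insert z (insert (x (i + 1)) U)) c) :
    ∀ v ∈ insert z (insert (x (i + 1)) U), c v = 0 := by
  have him : i < m := hik.trans hkm
  refine (D.minPos_sewn him).eq_zero_of_card (Finset.insert_subset_insert _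
    (Finset.insert_subset (D.x_mem_V him) hU)) ?_ hc
  have : insert z (insert (x (i + 1)) U) \ insert z (insert (x (i + 1)) (T i)) ⊆ U \ T i := by
    intro v hv
    simp only [Finset.mem_sdiff, Finset.mem_insert] at hv ⊢
    tauto
  have := Finset.card_le_card this
  rw [Finset.card_sdiff_of_subset hTU, hcard, D.card_T i him.le] at this
  omega

/-- The combinatorial form of the criterion for a universal set to survive sewing. -/
theorem universal_iff [FiniteDimensional ℝ W] (D : SewingData h V z m x y T) {i k : ℕ}
    (hik : i < k) (hkm : k < m) {U : Finset α} (hU : U ⊆ V) (hcard : U.card = 2 * k)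
    (hTU : T i ⊆ U) (hxU : x (i + 1) ∉ U)
    (hf : ∀ S ⊆ V, S.card ≤ m - k → FaceOn h V (S ∪ U)) :
    (∀ S ⊆ insert z V, S.card ≤ m - k → FaceOn h (insert z V) (S ∪ U)) ↔
      Even i ∧ ∀ S ⊆ insert z V, S.card ≤ m - k - 1 →
        FaceOn h (insert z V) (S ∪ insert z (insert (x (i + 1)) U)) := by
  have hUz : U ⊆ insert z V := hU.trans (Finset.subset_insert _ _)
  have hWz : insert z (insert (x (i + 1)) U) ⊆ insert z V := Finset.insert_subset_insert _
    (Finset.insert_subset (D.x_mem_V (hik.trans hkm)) hU)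
  constructor
  · intro hface
    have hm := SewnPolytope.minPos_of_faceOn hUz
      (fun c hc => D.eq_zero_of_card_le hU (by omega) hc) hface
    have hi := D.even_of_minPos hik hkm hU hcard hTU hxU hf hm
    exact ⟨hi, fun S hS hSc =>
      (D.minPos_insert_of_minPos hik hkm hU hcard hTU hxU hi hm).faceOn hWz hS hSc⟩
  · rintro ⟨hi, hface⟩ S hS hSc
    have hm := SewnPolytope.minPos_of_faceOn hWz (D.eq_zero_of_insert hik hkm hU hcard hTU) hface
    exact (D.minPos_of_minPos_insert hik hkm hU hcard hTU hxU hf hi hm).faceOn hUz hS hSc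

end SewingData

/-! ### From polytopes to homogeneous coordinates. -/

section Homogeneous

variable {E : Type*} [NormedAddCommGroup E] [NormedSpace ℝ E]

/-- Homogeneous coordinates. -/
def homog (v : E) : E × ℝ := (v, 1)

lemma map_homog_sub (φ : E × ℝ →ₗ[ℝ] ℝ) (p q : E) :
    φ (p - q, 0) = φ (homog p) - φ (homog q) := by
  rw [← map_sub]
  simp [homog]

lemma map_homog_sum (φ : E × ℝ →ₗ[ℝ] ℝ) {V : Finset E} {w : E → ℝ} (hw : ∑ v ∈ V, w v = 1) :
    φ (homog (∑ v ∈ V, w v • v)) = ∑ v ∈ V, w v * φ (homog v) := by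
  have : homog (∑ v ∈ V, w v • v) = ∑ v ∈ V, w v • homog v := by
    ext
    · simp [homog, Prod.fst_sum]
    · simp [homog, Prod.snd_sum, hw]
  rw [this, map_sum]
  simp

lemma map_homog_nonneg {φ : E × ℝ →ₗ[ℝ] ℝ} {V : Finset E} (hφ : ∀ v ∈ V, 0 ≤ φ (homog v)) {p : E}
    (hp : p ∈ convexHull ℝ (V : Set E)) : 0 ≤ φ (homog p) := by
  obtain ⟨w, hw0, hw1, rfl⟩ := Finset.mem_convexHull'.1 hp
  rw [map_homog_sum φ hw1]
  exact Finset.sum_nonneg fun v hv => mul_nonneg (hw0 v hv) (hφ v hv)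

lemma map_homog_eq_zero {φ : E × ℝ →ₗ[ℝ] ℝ} {V : Finset E} (hφ : ∀ v ∈ V, φ (homog v) = 0) {p : E}
    (hp : p ∈ convexHull ℝ (V : Set E)) : φ (homog p) = 0 := by
  obtain ⟨w, -, hw1, rfl⟩ := Finset.mem_convexHull'.1 hp
  rw [map_homog_sum φ hw1]
  exact Finset.sum_eq_zero fun v hv => by simp [hφ v hv]

lemma isDep_homog_iff {X : Finset E} {c : E → ℝ} :
    IsDep homog X c ↔ ∑ v ∈ X, c v = 0 ∧ ∑ v ∈ X, c v • v = 0 := by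
  rw [IsDep, Prod.ext_iff, and_comm]
  simp [homog, Prod.fst_sum, Prod.snd_sum]

lemma affineIndependent_of_isDep {X : Finset E}
    (hX : ∀ c, IsDep homog X c → ∀ v ∈ X, c v = 0) :
    AffineIndependent ℝ ((↑) : X → E) := by
  classical
  rw [affineIndependent_iff_of_fintype]
  intro w hw0 hw1
  rw [Finset.weightedVSub_eq_linear_combination _ hw0] at hw1
  set c : E → ℝ := fun v => if hv : v ∈ X then w ⟨v, hv⟩ else 0 with hc
  have h1 : IsDep homog X c := by
    rw [isDep_homog_iff, ← Finset.sum_coe_sort X, ← Finset.sum_coe_sort X]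
    simp only [hc, Finset.coe_mem, dite_true, Subtype.coe_eta]
    exact ⟨hw0, hw1⟩
  intro v
  simpa [hc] using hX c h1 v v.2

lemma finrank_vectorSpan_of_isDep {X : Finset E}
    (hX : ∀ c, IsDep homog X c → ∀ v ∈ X, c v = 0) {n : ℕ} (hn : X.card = n + 1) :
    Module.finrank ℝ (vectorSpan ℝ (X : Set E)) = n := by
  have := (affineIndependent_of_isDep hX).finrank_vectorSpan (n := n) (by simpa using hn)
  rwa [Subtype.range_coe_subtype] at this

lemma vectorSpan_convexHull_eq (A : Set E) : vectorSpan ℝ (convexHull ℝ A) = vectorSpan ℝ A := by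
  rw [← direction_affineSpan, affineSpan_convexHull, direction_affineSpan]

lemma affDim_convexHull (A : Set E) : affDim (convexHull ℝ A) = affDim A := by
  rw [affDim, vectorSpan_convexHull_eq, affDim]

lemma mem_of_mem_convexHull {V A : Finset E}
    (hV : vertices (convexHull ℝ (V : Set E)) = V) (hA : A ⊆ V) {v : E} (hv : v ∈ V)
    (hvA : v ∈ convexHull ℝ (A : Set E)) : v ∈ A := by
  have h1 : v ∈ vertices (convexHull ℝ (V : Set E)) := by rw [hV]; exact hv
  exact extremePoints_convexHull_subset (𝕜 := ℝ)
    (inter_extremePoints_subset_extremePoints_of_subset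
      (convexHull_mono (Finset.coe_subset.2 hA)) ⟨hvA, h1⟩)

lemma FaceOn.of_isFace {V A : Finset E} (hV : vertices (convexHull ℝ (V : Set E)) = V) (hA : A ⊆ V)
    (hface : IsFace (convexHull ℝ (V : Set E)) (convexHull ℝ (A : Set E))) :
    FaceOn homog V A := by
  rcases A.eq_empty_or_nonempty with rfl | ⟨a, ha⟩
  -- The empty face is cut out by the form that equals `1` on all points.
  · exact ⟨LinearMap.snd ℝ E ℝ, by simp, fun v _ _ => by simp [homog]⟩
  · have haA : a ∈ convexHull ℝ (A : Set E) := subset_convexHull ℝ _ ha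
    obtain ⟨l, hl⟩ := hface ⟨a, haA⟩
    have hmax : ∀ p, p ∈ convexHull ℝ (A : Set E) →
        ∀ y ∈ convexHull ℝ (V : Set E), l y ≤ l p := fun p hp => by
      rw [hl] at hp
      exact hp.2
    have hsub : ∀ p ∈ convexHull ℝ (A : Set E), p ∈ convexHull ℝ (V : Set E) :=
      fun p hp => convexHull_mono (Finset.coe_subset.2 hA) hp
    let φ : E × ℝ →ₗ[ℝ] ℝ :=
      l a • LinearMap.snd ℝ E ℝ - l.toLinearMap ∘ₗ LinearMap.fst ℝ E ℝ
    have hφ : ∀ v, φ (homog v) = l a - l v := fun v => by simp [φ, homog]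
    refine ⟨φ, fun v hv => ?_, fun v hv hvA => ?_⟩
    · have hvA : v ∈ convexHull ℝ (A : Set E) := subset_convexHull ℝ _ hv
      rw [hφ, sub_eq_zero]
      exact le_antisymm (hmax v hvA a (hsub a haA)) (hmax a haA v (hsub v hvA))
    · rw [hφ, sub_pos]
      by_contra! hle
      refine hvA (mem_of_mem_convexHull hV hA hv ?_)
      rw [hl]
      exact ⟨subset_convexHull ℝ _ hv, fun y hy => (hmax a haA y hy).trans hle⟩

lemma convexHull_extremePoints_eq {Q : Set E} (hQ : IsCompact Q) (hconv : Convex ℝ Q)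
    (hfin : (Q.extremePoints ℝ).Finite) : convexHull ℝ (Q.extremePoints ℝ) = Q := by
  rw [← (hfin.isClosed_convexHull ℝ).closure_eq, closure_convexHull_extremePoints hQ hconv]

lemma IsPolytope.exists_finset {P : Set E} (hP : IsPolytope P) :
    ∃ V : Finset E, (V : Set E) = vertices P ∧ convexHull ℝ (V : Set E) = P := by
  obtain ⟨s, -, rfl⟩ := hP
  have hfin : ((convexHull ℝ (s : Set E)).extremePoints ℝ).Finite :=
    s.finite_toSet.subset extremePoints_convexHull_subset
  exact ⟨hfin.toFinset, by simp, by
    simpa using convexHull_extremePoints_eq (s.finite_toSet.isCompact_convexHull ℝ)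
      (convex_convexHull ℝ _) hfin⟩

/-- A face is the convex hull of the vertices it contains. -/
lemma IsFace.exists_finset {V : Finset E} (hV : vertices (convexHull ℝ (V : Set E)) = V) {U : Set E}
    (hU : IsFace (convexHull ℝ (V : Set E)) U) : ∃ u ⊆ V, U = convexHull ℝ (u : Set E) := by
  have hsub : U.extremePoints ℝ ⊆ V := by
    rw [← hV]
    exact hU.isExtreme.extremePoints_subset_extremePoints
  have hfin := V.finite_toSet.subset hsub
  refine ⟨hfin.toFinset, by simpa using hsub, ?_⟩
  simpa using (convexHull_extremePoints_eq
    (hU.isCompact (V.finite_toSet.isCompact_convexHull ℝ)) (hU.convex (convex_convexHull ℝ _))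
    hfin).symm

lemma eq_zero_of_vectorSpan_eq_top {V : Finset E} (hne : V.Nonempty)
    (hV : vectorSpan ℝ (V : Set E) = ⊤) (φ : E × ℝ →ₗ[ℝ] ℝ) (hφ : ∀ v ∈ V, φ (homog v) = 0) :
    φ = 0 := by
  have h1 : vectorSpan ℝ (V : Set E) ≤ LinearMap.ker (φ ∘ₗ LinearMap.inl ℝ E ℝ) := by
    rw [vectorSpan_def, Submodule.span_le]
    rintro _ ⟨p, hp, q, hq, rfl⟩
    simp only [vsub_eq_sub, SetLike.mem_coe, LinearMap.mem_ker, LinearMap.comp_apply,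
      LinearMap.inl_apply]
    rw [map_homog_sub, hφ p hp, hφ q hq, sub_zero]
  rw [hV, top_le_iff, LinearMap.ker_eq_top] at h1
  obtain ⟨v, hv⟩ := hne
  have h2 : ∀ p : E, φ (p, 0) = 0 := fun p => by simpa using LinearMap.congr_fun h1 p
  have h3 : φ (0, 1) = 0 := by
    have : φ (homog v) = φ (v, 0) + φ (0, 1) := by rw [← map_add]; simp [homog]
    rw [hφ v hv, h2] at this
    linarith
  ext p
  · simpa using h2 p
  · simpa using h3

/-- If `φ` were positive at both `w` and `z`, it would be positive on the whole segment between
them, which therefore could not meet the hyperplane. -/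
lemma neg_of_isBeyond {P F : Set E} {φ : E × ℝ →ₗ[ℝ] ℝ} {w z : E} (hF : ∀ p, p ∈ affineSpan ℝ F ↔ φ (homog p) = 0)
    (hw : 0 < φ (homog w)) (hwP : w ∈ P) (hz : IsBeyond P F z) : φ (homog z) < 0 := by
  by_contra! hnn
  have hzF := hz.1
  rw [hF] at hzF
  obtain ⟨p, hp, hb⟩ := AffineSubspace.wOppSide_iff_exists_wbtw.1 (hz.2 w hwP)
  obtain ⟨t, ⟨ht0, ht1⟩, rfl⟩ := hb
  rw [hF] at hp
  have hval : φ (homog (AffineMap.lineMap w z t)) = (1 - t) * φ (homog w) + t * φ (homog z) := by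
    have : homog (AffineMap.lineMap w z t) = (1 - t) • homog w + t • homog z := by
      ext <;> simp [homog, AffineMap.lineMap_apply_module]
    rw [this, map_add, map_smul, map_smul, smul_eq_mul, smul_eq_mul]
  rw [hval] at hp
  have hzpos := hnn.lt_of_ne' hzF
  rcases ht0.lt_or_eq with h | rfl
  · nlinarith [mul_pos h hzpos, mul_nonneg (sub_nonneg.2 ht1) hw.le]
  · linarith

lemma pos_of_isBeneath {P F : Set E} {φ : E × ℝ →ₗ[ℝ] ℝ} {z : E} (hF : ∀ p, p ∈ affineSpan ℝ F ↔ φ (homog p) = 0)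
    (hφ : ∀ p ∈ P, 0 ≤ φ (homog p)) (hz : IsBeneath P F z) : 0 < φ (homog z) := by
  have hzF := hz.1
  have hzF' := hz.1
  rw [hF] at hzF
  by_contra! hle
  have hneg := hle.lt_of_ne hzF
  refine hz.2 ⟨hzF', fun p hp => AffineSubspace.wOppSide_iff_exists_wbtw.2 ?_⟩
  have hpn := hφ p hp
  have hden : 0 < φ (homog p) - φ (homog z) := by linarith
  -- The parameter at which the segment from `p` to `z` crosses the zero set of `φ`.
  set t := φ (homog p) / (φ (homog p) - φ (homog z)) with ht
  refine ⟨AffineMap.lineMap p z t, ?_, t, ⟨by positivity, ?_⟩, rfl⟩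
  · have : homog (AffineMap.lineMap p z t) = (1 - t) • homog p + t • homog z := by
      ext <;> simp [homog, AffineMap.lineMap_apply_module]
    rw [hF, this, map_add, map_smul, map_smul, smul_eq_mul, smul_eq_mul, ht]
    field_simp
    ring
  · rw [ht, div_le_one hden]
    linarith

variable [FiniteDimensional ℝ E]

/-- The zero set of a form that is nonnegative on a set is an exposed face. -/
lemma isFace_zeros {P : Set E} (φ : E × ℝ →ₗ[ℝ] ℝ) (hφ : ∀ p ∈ P, 0 ≤ φ (homog p)) :
    IsFace P {p ∈ P | φ (homog p) = 0} := by
  rintro ⟨a, haP, ha⟩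
  refine ⟨LinearMap.toContinuousLinearMap (-(φ ∘ₗ LinearMap.inl ℝ E ℝ)), ?_⟩
  have key : ∀ p q : E, LinearMap.toContinuousLinearMap (-(φ ∘ₗ LinearMap.inl ℝ E ℝ)) p ≤
      LinearMap.toContinuousLinearMap (-(φ ∘ₗ LinearMap.inl ℝ E ℝ)) q ↔
      φ (homog q) ≤ φ (homog p) := fun p q => by
    have := map_homog_sub φ p q
    have h2 : φ (p - q, 0) = φ (p, 0) - φ (q, 0) := by rw [← map_sub]; simp
    simp only [LinearMap.coe_toContinuousLinearMap', LinearMap.neg_apply, LinearMap.comp_apply,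
      LinearMap.inl_apply]
    constructor <;> intro <;> linarith
  ext p
  simp only [Set.mem_ofPred_eq, key]
  exact and_congr_right fun hp => ⟨fun h q hq => h ▸ hφ q hq,
    fun h => le_antisymm ((h a haP).trans_eq ha) (hφ p hp)⟩

lemma FaceOn.isFace {V A : Finset E} (hA : A ⊆ V) (hface : FaceOn homog V A) :
    IsFace (convexHull ℝ (V : Set E)) (convexHull ℝ (A : Set E)) := by
  obtain ⟨φ, h0, h1⟩ := hface
  have hnn : ∀ v ∈ V, 0 ≤ φ (homog v) := fun v hv => by
    by_cases hvA : v ∈ A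
    · exact (h0 v hvA).ge
    · exact (h1 v hv hvA).le
  have := isFace_zeros φ (P := convexHull ℝ (V : Set E)) fun p hp => map_homog_nonneg hnn hp
  convert this using 1
  ext p
  refine ⟨fun hp => ⟨convexHull_mono (Finset.coe_subset.2 hA) hp, map_homog_eq_zero h0 hp⟩, ?_⟩
  rintro ⟨hp, hp0⟩
  obtain ⟨w, hw0, hw1, rfl⟩ := Finset.mem_convexHull'.1 hp
  rw [map_homog_sum φ hw1, Finset.sum_eq_zero_iff_of_nonneg
    fun v hv => mul_nonneg (hw0 v hv) (hnn v hv)] at hp0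
  have hz : ∀ v ∈ V, v ∉ A → w v = 0 := fun v hv hvA =>
    (mul_eq_zero.1 (hp0 v hv)).resolve_right (h1 v hv hvA).ne'
  refine Finset.mem_convexHull'.2 ⟨w, fun v hv => hw0 v (hA hv), ?_, ?_⟩
  · rw [← hw1]
    exact Finset.sum_subset hA hz
  · exact Finset.sum_subset hA fun v hv hvA => by simp [hz v hv hvA]

lemma isFace_iff_faceOn {V A : Finset E} (hV : vertices (convexHull ℝ (V : Set E)) = V)
    (hA : A ⊆ V) :
    IsFace (convexHull ℝ (V : Set E)) (convexHull ℝ (A : Set E)) ↔ FaceOn homog V A :=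
  ⟨FaceOn.of_isFace hV hA, FaceOn.isFace hA⟩

lemma vertices_convexHull_of_faceOn {X : Finset E} (hX : ∀ v ∈ X, FaceOn homog X {v}) :
    vertices (convexHull ℝ (X : Set E)) = X := by
  refine subset_antisymm extremePoints_convexHull_subset fun v hv => ?_
  have := (hX v hv).isFace (by simpa using hv)
  rw [Finset.coe_singleton, convexHull_singleton] at this
  exact exposedPoints_subset_extremePoints (mem_exposedPoints_iff_exposed_singleton.2 this)

/-- Universality of `conv A` in terms of linear forms. -/
lemma isUniversalFace_iff [DecidableEq E] {X A : Finset E}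
    (hX : vertices (convexHull ℝ (X : Set E)) = X) (hA : A ⊆ X) (hne : A.Nonempty) {d : ℕ} :
    IsUniversalFace (convexHull ℝ (X : Set E)) d (convexHull ℝ (A : Set E)) ↔
      affDim (convexHull ℝ (A : Set E)) = d ∧ ∀ S ⊆ X,
        S.card ≤ (affDim (convexHull ℝ (X : Set E)) - d - 1) / 2 → FaceOn homog X (S ∪ A) := by
  have key : ∀ S : Finset E, S ⊆ X →
      (IsFace (convexHull ℝ (X : Set E)) (convexHull ℝ ((S : Set E) ∪ convexHull ℝ (A : Set E))) ↔
        FaceOn homog X (S ∪ A)) := fun S hS => by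
    rw [← isFace_iff_faceOn hX (Finset.union_subset hS hA), Finset.coe_union,
      convexHull_convexHull_union_right]
  constructor
  · rintro ⟨⟨-, -, hd⟩, h⟩
    exact ⟨hd, fun S hS hc => (key S hS).1 (h S (by rw [hX]; exact_mod_cast hS) hc)⟩
  · rintro ⟨hd, h⟩
    refine ⟨⟨(Finset.coe_nonempty.2 hne).convexHull, ?_, hd⟩, fun S hS hc => ?_⟩
    · rw [isFace_iff_faceOn hX hA]
      simpa using h ∅ (by simp) (by simp)
    · rw [hX] at hS
      exact (key S (by exact_mod_cast hS)).2 (h S (by exact_mod_cast hS) hc)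

variable {V : Finset E} {φ : E × ℝ →ₗ[ℝ] ℝ} {Z : Finset E} {w : E}

/-- The independent points of `Z` bound the dimension from below by `finrank E - 1`; `φ` is not
constant, since it is positive at `w`, which gives the matching upper bound. -/
lemma vectorSpan_zeros (hZV : Z ⊆ V) (hZ : ∀ v ∈ Z, φ (homog v) = 0)
    (hind : ∀ c, IsDep homog Z c → ∀ v ∈ Z, c v = 0) (hcard : Z.card = Module.finrank ℝ E)
    (hne : Z.Nonempty) (hw : 0 < φ (homog w)) :
    vectorSpan ℝ {p ∈ convexHull ℝ (V : Set E) | φ (homog p) = 0} =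
      LinearMap.ker (φ ∘ₗ LinearMap.inl ℝ E ℝ) ∧
    Module.finrank ℝ (vectorSpan ℝ {p ∈ convexHull ℝ (V : Set E) | φ (homog p) = 0}) + 1 =
      Module.finrank ℝ E := by
  obtain ⟨a, ha⟩ := hne
  have hcpos : 0 < Z.card := Finset.card_pos.2 ⟨a, ha⟩
  have hle : vectorSpan ℝ {p ∈ convexHull ℝ (V : Set E) | φ (homog p) = 0} ≤
      LinearMap.ker (φ ∘ₗ LinearMap.inl ℝ E ℝ) := by
    rw [vectorSpan_def, Submodule.span_le]
    rintro _ ⟨p, ⟨-, hp⟩, q, ⟨-, hq⟩, rfl⟩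
    simp only [vsub_eq_sub, SetLike.mem_coe, LinearMap.mem_ker, LinearMap.comp_apply,
      LinearMap.inl_apply]
    rw [map_homog_sub, hp, hq, sub_zero]
  have hlt : LinearMap.ker (φ ∘ₗ LinearMap.inl ℝ E ℝ) < ⊤ := by
    rw [lt_top_iff_ne_top, Ne, LinearMap.ker_eq_top]
    intro h0
    have h1 : φ (w - a, 0) = 0 := by simpa using LinearMap.congr_fun h0 (w - a)
    rw [map_homog_sub, hZ a ha] at h1
    linarith
  have h1 := Submodule.finrank_lt hlt.ne
  have h2 := finrank_vectorSpan_of_isDep hind (n := Z.card - 1) (by omega)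
  have h3 : vectorSpan ℝ (Z : Set E) ≤
      vectorSpan ℝ {p ∈ convexHull ℝ (V : Set E) | φ (homog p) = 0} :=
    vectorSpan_mono ℝ fun v hv => ⟨subset_convexHull ℝ _ (hZV hv), hZ v hv⟩
  have h4 := Submodule.finrank_mono h3
  have h5 := Submodule.finrank_mono hle
  exact ⟨Submodule.eq_of_le_of_finrank_le hle (by omega), by omega⟩

lemma mem_affineSpan_zeros (hZV : Z ⊆ V) (hZ : ∀ v ∈ Z, φ (homog v) = 0)
    (hind : ∀ c, IsDep homog Z c → ∀ v ∈ Z, c v = 0) (hcard : Z.card = Module.finrank ℝ E)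
    (hne : Z.Nonempty) (hw : 0 < φ (homog w)) {p : E} :
    p ∈ affineSpan ℝ {p ∈ convexHull ℝ (V : Set E) | φ (homog p) = 0} ↔ φ (homog p) = 0 := by
  have hspan := (vectorSpan_zeros hZV hZ hind hcard hne hw).1
  obtain ⟨a, ha⟩ := hne
  have haF : a ∈ affineSpan ℝ {p ∈ convexHull ℝ (V : Set E) | φ (homog p) = 0} :=
    subset_affineSpan ℝ _ ⟨subset_convexHull ℝ _ (hZV ha), hZ a ha⟩
  rw [← AffineSubspace.vsub_right_mem_direction_iff_mem haF, direction_affineSpan, hspan,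
    LinearMap.mem_ker, LinearMap.comp_apply, LinearMap.inl_apply, vsub_eq_sub, map_homog_sub,
    hZ a ha, sub_zero]

end Homogeneous

/-- Sets of at most `m` elements are faces as soon as sets of exactly `m` elements are. -/
lemma faceOn_of_card_le {α W : Type*} [AddCommGroup W] [Module ℝ W] {h : α → W}
    {V : Finset α} {m : ℕ} (hm : m < V.card) (hf : ∀ S ⊆ V, S.card = m → FaceOn h V S)
    {S : Finset α} (hS : S ⊆ V) (hc : S.card ≤ m) : FaceOn h V S := by
  classical
  choose! φ h0 h1 using hf
  have hnn : ∀ R ⊆ V, R.card = m → ∀ v ∈ V, 0 ≤ φ R (h v) := fun R hR hRc v hv => by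
    by_cases hvR : v ∈ R
    · exact (h0 R hR hRc v hvR).ge
    · exact (h1 R hR hRc v hv hvR).le
  -- The sum over all `m`-sets containing `S` is positive at each `v ∉ S`, because some such `m`-set
  -- avoids `v`.
  refine ⟨∑ R ∈ (V.powersetCard m).filter (S ⊆ ·), φ R, fun v hv => ?_, fun v hv hvS => ?_⟩
  · rw [LinearMap.sum_apply]
    refine Finset.sum_eq_zero fun R hR => ?_
    simp only [Finset.mem_filter, Finset.mem_powersetCard] at hR
    exact h0 R hR.1.1 hR.1.2 v (hR.2 hv)
  · rw [LinearMap.sum_apply]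
    obtain ⟨R, hSR, hRV, hRc⟩ := Finset.exists_subsuperset_card_eq
      (fun s hs => Finset.mem_erase.2 ⟨fun h => hvS (h ▸ hs), hS hs⟩ : S ⊆ V.erase v) hc
      (by rw [Finset.card_erase_of_mem hv]; omega)
    have hvR : v ∉ R := fun h => (Finset.mem_erase.1 (hRV h)).1 rfl
    have hRV' : R ⊆ V := hRV.trans (Finset.erase_subset _ _)
    refine Finset.sum_pos' (fun Q hQ => ?_) ⟨R, ?_, h1 R hRV' hRc v hv hvR⟩
    · simp only [Finset.mem_filter, Finset.mem_powersetCard] at hQ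
      exact hnn Q hQ.1.1 hQ.1.2 v hv
    · simp [Finset.mem_powersetCard, hRV', hRc, hSR]


/-! ### The tower, the sewn polytope and the final translation. -/

section Tower

/-- The vertices of `towerFace x y j`. -/
def towerFinset {α : Type*} [DecidableEq α] (x y : ℕ → α) (j : ℕ) : Finset α :=
  (Finset.Icc 1 j).image x ∪ (Finset.Icc 1 j).image y

lemma mem_towerFinset {α : Type*} [DecidableEq α] {x y : ℕ → α} {j : ℕ} {v : α} :
    v ∈ towerFinset x y j ↔ ∃ l, (1 ≤ l ∧ l ≤ j) ∧ (x l = v ∨ y l = v) := by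
  simp only [towerFinset, Finset.mem_union, Finset.mem_image, Finset.mem_Icc]
  constructor
  · rintro (⟨l, hl, h⟩ | ⟨l, hl, h⟩)
    exacts [⟨l, hl, Or.inl h⟩, ⟨l, hl, Or.inr h⟩]
  · rintro ⟨l, hl, h | h⟩
    exacts [Or.inl ⟨l, hl, h⟩, Or.inr ⟨l, hl, h⟩]

variable {E : Type*} [NormedAddCommGroup E] [NormedSpace ℝ E]

/-- If small sets are independent, the dimension determines the number of elements. -/
lemma card_eq_of_affDim [FiniteDimensional ℝ E] {U : Finset E} {n k : ℕ} (hne : U.Nonempty) (hkn : k + 2 ≤ n)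
    (hind : ∀ Y ⊆ U, Y.card ≤ n → ∀ c, IsDep homog Y c → ∀ v ∈ Y, c v = 0)
    (hdim : affDim (U : Set E) = k) : U.card = k + 1 := by
  have hpos := Finset.card_pos.2 hne
  have hle : U.card ≤ k + 1 := by
    by_contra! hlt
    -- As `k + 2 ≤ n`, such a subset is still independent and would span dimension `k + 1`.
    obtain ⟨Y, hYU, hYc⟩ := Finset.exists_subset_card_eq (show k + 2 ≤ U.card by omega)
    have h1 := finrank_vectorSpan_of_isDep (hind Y hYU (by omega)) (n := k + 1) hYc
    have h2 := Submodule.finrank_mono (vectorSpan_mono ℝ (Finset.coe_subset.2 hYU))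
    rw [h1] at h2
    unfold affDim at hdim
    omega
  have := finrank_vectorSpan_of_isDep (hind U subset_rfl (by omega)) (n := U.card - 1) (by omega)
  unfold affDim at hdim
  omega

variable [DecidableEq E]

lemma towerFace_eq (x y : ℕ → E) (j : ℕ) :
    towerFace x y j = convexHull ℝ (towerFinset x y j : Set E) := by
  simp [towerFace, towerFinset]

variable {P : Set E} {V : Finset E} {z : E} {m : ℕ} {x y : ℕ → E}

lemma towerFace_subset_iff {F : Set E} (hF : Convex ℝ F) {j : ℕ} :
    towerFace x y j ⊆ F ↔ ∀ v ∈ towerFinset x y j, v ∈ F := by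
  rw [towerFace_eq, hF.convexHull_subset_iff]
  rfl

/-- A facet through `Φ_j` but not through `Φ_{j+1}` belongs to `𝒞(𝒯)` exactly if `j` is odd. -/
lemma mem_towerFacets_iff {F : Set E} (hFc : Convex ℝ F) (hF : IsFacet P F) {j : ℕ} (hj : j ≤ m)
    (hT : ∀ v ∈ towerFinset x y j, v ∈ F) {w : E} (hwF : w ∉ F)
    (hw : j < m → w ∈ towerFinset x y (j + 1)) : F ∈ towerFacets P m x y ↔ Odd j := by
  -- Membership in `𝒞(𝒯)` thus means `2r + 1 ≤ j < 2r + 2` for some `r`.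
  have key : ∀ l, F ∈ facetsThrough P m x y l ↔ l ≤ j := by
    intro l
    simp only [facetsThrough, Set.mem_ofPred_eq, towerFace_subset_iff hFc, hF, true_and]
    constructor
    · rintro ⟨hlm, hl⟩
      by_contra! hlt
      obtain ⟨i, hi, hi'⟩ := mem_towerFinset.1 (hw (by omega))
      exact hwF (hl w (mem_towerFinset.2 ⟨i, by omega, hi'⟩))
    · intro hl
      refine ⟨hl.trans hj, fun v hv => ?_⟩
      obtain ⟨i, hi, hi'⟩ := mem_towerFinset.1 hv
      exact hT v (mem_towerFinset.2 ⟨i, by omega, hi'⟩)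
  simp only [towerFacets, Set.mem_iUnion, Set.mem_sdiff, key]
  constructor
  · rintro ⟨r, h1, h2⟩
    exact ⟨r, by omega⟩
  · rintro ⟨r, rfl⟩
    exact ⟨r, by omega, by omega⟩

variable [FiniteDimensional ℝ E]

/-- The hypotheses of the theorem, in homogeneous coordinates. -/
lemma sewingData (hm : 2 ≤ m) (hE : Module.finrank ℝ E = 2 * m) (hP : IsNeighbourly P)
    (hdim : affDim P = 2 * m) (hVP : (V : Set E) = vertices P)
    (hconv : convexHull ℝ (V : Set E) = P) (hcard : 2 * m + 3 ≤ V.card)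
    (hT : IsUniversalTower P m x y) (hz : IsExactlyBeyond P (towerFacets P m x y) z) :
    SewingData homog V z m x y (towerFinset x y) := by
  have hV : vertices (convexHull ℝ (V : Set E)) = V := by rw [hconv, hVP]
  have hne : V.Nonempty := Finset.card_pos.1 (by omega)
  have hface0 : ∀ S ⊆ V, S.card ≤ m → FaceOn homog V S := fun S hS hc =>
    faceOn_of_card_le (by omega) (fun S hS hc => by
      rw [← isFace_iff_faceOn hV hS, hconv]
      exact (hP.2 S (by rw [← hVP]; exact_mod_cast hS) (by rw [hdim]; omega)).1) hS hc
  have hmin : MinPos homog V ∅ m :=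
    minPos_of_faceOn (by simp) (by simp) (by simpa using hface0)
  have hxV : ∀ l, 1 ≤ l → l ≤ m → x l ∈ V := fun l h1 h2 => by
    have := hT.x_mem l ⟨h1, h2⟩
    rw [← hVP] at this
    exact_mod_cast this
  have hyV : ∀ l, 1 ≤ l → l ≤ m → y l ∈ V := fun l h1 h2 => by
    have := hT.y_mem l ⟨h1, h2⟩
    rw [← hVP] at this
    exact_mod_cast this
  have hTV : ∀ j ≤ m, towerFinset x y j ⊆ V := by
    intro j hj v hv
    obtain ⟨l, hl, rfl | rfl⟩ := mem_towerFinset.1 hv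
    · exact hxV l hl.1 (hl.2.trans hj)
    · exact hyV l hl.1 (hl.2.trans hj)
  have hT0 : towerFinset x y 0 = ∅ := by simp [towerFinset]
  have hface : ∀ j ≤ m, ∀ S ⊆ V, S.card ≤ m - j → FaceOn homog V (S ∪ towerFinset x y j) := by
    intro j hj S hS hc
    rcases Nat.eq_zero_or_pos j with rfl | hpos
    · rw [hT0, Finset.union_empty]
      exact hface0 S hS (by omega)
    · have hu := (hT.universal j ⟨hpos, hj⟩).2 S (by rw [← hVP]; exact_mod_cast hS)
        (by rw [hdim]; omega)
      rwa [towerFace_eq, convexHull_convexHull_union_right, ← Finset.coe_union, ← hconv,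
        isFace_iff_faceOn hV (Finset.union_subset hS (hTV j hj))] at hu
  have hspan : vectorSpan ℝ (V : Set E) = ⊤ := by
    refine Submodule.eq_top_of_finrank_eq ?_
    rw [hE, ← hdim, ← hconv, affDim, vectorSpan_convexHull_eq]
  have hrank : Module.finrank ℝ (E × ℝ) = 2 * m + 1 := by
    rw [Module.finrank_prod, hE, Module.finrank_self]
  have hfacet : ∀ A ⊆ V, FaceOn homog V A → ∀ j ≤ m, towerFinset x y j ⊆ A → ∀ w ∈ V, w ∉ A →
      (j < m → w ∈ towerFinset x y (j + 1)) →
      ∃ φ : E × ℝ →ₗ[ℝ] ℝ, (∀ v ∈ V, 0 ≤ φ (homog v)) ∧ (∀ v ∈ A, φ (homog v) = 0) ∧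
        (Even j → 0 < φ (homog z)) ∧ (Odd j → φ (homog z) < 0) := by
    intro A hA hAf j hj hTA w hw hwA hwT
    obtain ⟨φ, h1, h2, h3, h4⟩ := hAf.exists_facet hrank
      (eq_zero_of_vectorSpan_eq_top hne hspan) hw hwA hA
    -- These `2m` zeros are independent by neighbourliness, so the zero set of `φ` in `P` is a facet
    -- and its affine hull is the whole hyperplane.
    obtain ⟨Z, hZ, hZc⟩ := Finset.exists_subset_card_eq h4
    have hZV : Z ⊆ V := hZ.trans (Finset.filter_subset _ _)
    have hZ0 : ∀ v ∈ Z, φ (homog v) = 0 := fun v hv => (Finset.mem_filter.1 (hZ hv)).2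
    have hZne : Z.Nonempty := Finset.card_pos.1 (by omega)
    have hZi : ∀ c, IsDep homog Z c → ∀ v ∈ Z, c v = 0 := fun c hc =>
      hmin.eq_zero_of_card hZV (by simp [hZc]) hc
    have hspanF := vectorSpan_zeros hZV hZ0 hZi (hZc.trans hE.symm) hZne h3
    have haff := fun p => mem_affineSpan_zeros (p := p) hZV hZ0 hZi (hZc.trans hE.symm) hZne h3
    have hnn : ∀ p ∈ convexHull ℝ (V : Set E), 0 ≤ φ (homog p) :=
      fun p hp => map_homog_nonneg h1 hp
    have hFface := isFace_zeros φ hnn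
    rw [hconv] at hspanF haff hnn hFface
    set F : Set E := {p ∈ P | φ (homog p) = 0} with hF
    have hVsub : ∀ v ∈ V, v ∈ P := fun v hv => hconv ▸ subset_convexHull ℝ _ hv
    have hFacet : IsFacet P F := by
      obtain ⟨a, ha⟩ := hZne
      exact ⟨⟨a, hVsub a (hZV ha), hZ0 a ha⟩, hFface, by rw [hdim, ← hE]; exact hspanF.2⟩
    have hFc : Convex ℝ F := hFface.convex (hconv ▸ convex_convexHull ℝ _)
    have hmem := mem_towerFacets_iff hFc hFacet hj
      (fun v hv => ⟨hVsub v (hA (hTA hv)), h2 v (hTA hv)⟩) (fun h => h3.ne' h.2) hwT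
    refine ⟨φ, h1, h2, fun he => ?_, fun ho => ?_⟩
    · exact pos_of_isBeneath haff hnn
        (hz.2 F hFacet fun h => (Nat.not_odd_iff_even.2 he) (hmem.1 h))
    · exact neg_of_isBeyond haff h3 (hVsub w hw) (hz.1 F (hmem.2 ho))
  have hxT : ∀ j < m, x (j + 1) ∉ towerFinset x y j := by
    intro j hj h
    obtain ⟨l, hl, h | h⟩ := mem_towerFinset.1 h
    · have := hT.x_injOn ⟨hl.1, by omega⟩ ⟨by omega, hj⟩ h
      omega
    · exact hT.x_ne_y (j + 1) ⟨by omega, hj⟩ l ⟨hl.1, by omega⟩ h.symm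
  have hyT : ∀ j < m, y (j + 1) ∉ towerFinset x y j := by
    intro j hj h
    obtain ⟨l, hl, h | h⟩ := mem_towerFinset.1 h
    · exact hT.x_ne_y l ⟨hl.1, by omega⟩ (j + 1) ⟨by omega, hj⟩ h
    · have := hT.y_injOn ⟨hl.1, by omega⟩ ⟨by omega, hj⟩ h
      omega
  refine ⟨hrank, fun hzV => ?_, by omega, hmin, hT0, fun j hj => ?_, hxT, hyT,
    fun j hj => hT.x_ne_y _ ⟨by omega, hj⟩ _ ⟨by omega, hj⟩, hTV, hface, hfacet⟩
  -- A facet through `Φ_1` that misses `x 2` has `z` beyond it, so `z` is not a vertex of `P`.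
  · obtain ⟨φ, h1, -, -, h4⟩ := hfacet _ (hTV 1 (by omega))
      (by simpa using hface 1 (by omega) ∅ (by simp) (by simp)) 1 (by omega) subset_rfl (x 2)
      (hxV 2 (by omega) hm) (hxT 1 (by omega))
      fun _ => mem_towerFinset.2 ⟨2, by omega, Or.inl rfl⟩
    exact (h1 z hzV).not_gt (h4 odd_one)
  · ext v
    simp only [Finset.mem_insert, mem_towerFinset]
    constructor
    · rintro ⟨l, hl, h⟩
      rcases hl.2.lt_or_eq with hlt | rfl
      · exact Or.inr (Or.inr ⟨l, ⟨hl.1, by omega⟩, h⟩)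
      · rcases h with h | h
        · exact Or.inl h.symm
        · exact Or.inr (Or.inl h.symm)
    · rintro (rfl | rfl | ⟨l, hl, h⟩)
      · exact ⟨j + 1, by omega, Or.inl rfl⟩
      · exact ⟨j + 1, by omega, Or.inr rfl⟩
      · exact ⟨l, by omega, h⟩

/-- Sewing adds `z` to the vertices. -/
lemma SewingData.vertices_sewn {T : ℕ → Finset E} (D : SewingData homog V z m x y T) (hm : 2 ≤ m) :
    vertices (convexHull ℝ ((insert z V : Finset E) : Set E)) = (insert z V : Finset E) := by
  refine vertices_convexHull_of_faceOn fun v hv => ?_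
  have him : 0 < m := by omega
  refine faceOn_of_isDep (by simpa using hv) fun c hc hle => ?_
  by_contra! hne
  obtain ⟨w, hw, -, hw0⟩ := hne
  -- With `i = 0` there are at least `m ≥ 2` positive places, but only `v` can be one.
  have h1 := D.minPos_sewn him c hc ⟨w, hw, hw0⟩
  have h2 : ((insert z V).filter (0 < c ·)) \ insert z (insert (x (0 + 1)) (T 0)) ⊆ {v} := by
    intro u hu
    simp only [Finset.mem_sdiff, Finset.mem_filter] at hu
    by_contra huv
    exact (hle u hu.1.1 huv).not_gt hu.1.2
  have := Finset.card_le_card h2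
  rw [Finset.card_singleton] at this
  omega

/-- Once `U` is replaced by its `2k` vertices, both universality conditions become `FaceOn`
conditions on `insert z V`, and `SewingData.universal_iff` decides them. The dimension requirements
hold automatically by independence. -/
theorem isUniversalFace_sewn_iff (hE : Module.finrank ℝ E = 2 * m) (hP : IsNeighbourly P)
    (hdim : affDim P = 2 * m) (hcard : 2 * m + 3 ≤ (vertices P).ncard)
    (hT : IsUniversalTower P m x y) (hz : IsExactlyBeyond P (towerFacets P m x y) z) {i k : ℕ}
    (hik : i < k) (hkm : k < m) {U : Set E} (hU : IsUniversalFace P (2 * k - 1) U)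
    (hΦU : towerFace x y i ⊆ U) (hxU : x (i + 1) ∉ U) :
    IsUniversalFace (sewn P z) (2 * k - 1) U ↔
      Even i ∧ IsUniversalFace (sewn P z) (2 * k + 1) (convexHull ℝ (U ∪ {z, x (i + 1)})) := by
  obtain ⟨V, hVP, hconv⟩ := hP.1.exists_finset
  have hm : 2 ≤ m := by omega
  have D := sewingData hm hE hP hdim hVP hconv (by rwa [← hVP, Set.ncard_coe_finset] at hcard) hT hz
  have hV : vertices (convexHull ℝ (V : Set E)) = V := by rw [hconv, hVP]
  have hVz := D.vertices_sewn hm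
  have hsewn : sewn P z = convexHull ℝ ((insert z V : Finset E) : Set E) := by
    rw [sewn, ← hconv, Finset.coe_insert, Set.insert_eq, convexHull_convexHull_union_right,
      ← Set.insert_eq]
  have hdimz : affDim (sewn P z) = 2 * m := by
    refine le_antisymm (hE ▸ Submodule.finrank_le _) (hdim ▸ Submodule.finrank_mono ?_)
    exact vectorSpan_mono ℝ ((Set.subset_insert _ _).trans (subset_convexHull ℝ _))
  obtain ⟨u, huV, rfl⟩ := IsFace.exists_finset hV (hconv.symm ▸ hU.1.2.1)
  have hune : u.Nonempty := by simpa using hU.1.1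
  have hucard : u.card = 2 * k := by
    have := card_eq_of_affDim (n := 2 * m + 1) hune (by omega)
      (fun Y hY hc c => D.eq_zero_of_card_le (hY.trans huV) hc)
      ((affDim_convexHull _).symm.trans hU.1.2.2)
    omega
  have hTu : towerFinset x y i ⊆ u := fun v hv =>
    mem_of_mem_convexHull hV huV (D.T_subset i (by omega) hv)
      (hΦU (by rw [towerFace_eq]; exact subset_convexHull ℝ _ hv))
  have hxu : x (i + 1) ∉ u := fun h => hxU (subset_convexHull ℝ _ h)
  have huz : u ⊆ insert z V := huV.trans (Finset.subset_insert _ _)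
  have hudim := hU.1.2.2
  rw [← hconv, isUniversalFace_iff hV huV hune, hconv, hdim] at hU
  have hWz : insert z (insert (x (i + 1)) u) ⊆ insert z V := Finset.insert_subset_insert _
    (Finset.insert_subset (D.x_mem_V (by omega)) huV)
  have hW : convexHull ℝ (convexHull ℝ (u : Set E) ∪ {z, x (i + 1)}) =
      convexHull ℝ ((insert z (insert (x (i + 1)) u) : Finset E) : Set E) := by
    rw [convexHull_convexHull_union_left]
    congr 1
    ext v
    simp only [Set.mem_union, Set.mem_insert_iff, Set.mem_singleton_iff, Finset.coe_insert]
    tauto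
  have hWdim : affDim (convexHull ℝ ((insert z (insert (x (i + 1)) u) : Finset E) : Set E)) =
      2 * k + 1 := by
    rw [affDim_convexHull]
    refine finrank_vectorSpan_of_isDep (D.eq_zero_of_insert hik hkm huV hucard hTu) ?_
    rw [Finset.card_insert_of_notMem, Finset.card_insert_of_notMem hxu, hucard]
    rw [Finset.mem_insert, not_or]
    exact ⟨fun h => D.z_notMem (h ▸ D.x_mem_V (by omega)), fun h => D.z_notMem (huV h)⟩
  have e1 : (2 * m - (2 * k - 1) - 1) / 2 = m - k := by omega
  have e2 : (2 * m - (2 * k + 1) - 1) / 2 = m - k - 1 := by omega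
  rw [e1] at hU
  rw [hW, hsewn, isUniversalFace_iff hVz huz hune, isUniversalFace_iff hVz hWz (by simp), ← hsewn,
    hdimz, e1, e2, D.universal_iff hik hkm huV hucard hTu hxu hU.2]
  simp only [hudim, hWdim, true_and]

end Tower

end SewnPolytope

theorem theorem5p4 (m : ℕ) (P : Set (EuclideanSpace ℝ (Fin (2 * m))))
    (hP : SewnPolytope.IsNeighbourly P)
    (hdim : SewnPolytope.affDim P = 2 * m)
    (hcard : 2 * m + 3 ≤ (SewnPolytope.vertices P).ncard)
    (x y : ℕ → EuclideanSpace ℝ (Fin (2 * m)))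
    (hT : SewnPolytope.IsUniversalTower P m x y)
    (xbar : EuclideanSpace ℝ (Fin (2 * m)))
    (hxbar : SewnPolytope.IsExactlyBeyond P (SewnPolytope.towerFacets P m x y) xbar)
    (i k : ℕ) (hik : i < k) (hkm : k < m)
    (U : Set (EuclideanSpace ℝ (Fin (2 * m))))
    (hU : SewnPolytope.IsUniversalFace P (2 * k - 1) U)
    (hΦU : SewnPolytope.towerFace x y i ⊆ U)
    (hxU : x (i + 1) ∉ U) :
    SewnPolytope.IsUniversalFace (SewnPolytope.sewn P xbar) (2 * k - 1) U ↔
      Even i ∧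
        SewnPolytope.IsUniversalFace (SewnPolytope.sewn P xbar) (2 * k + 1)
          (convexHull ℝ (U ∪ {xbar, x (i + 1)})) := by
  classical
  exact SewnPolytope.isUniversalFace_sewn_iff finrank_euclideanSpace_fin hP hdim hcard hT hxbar hik
    hkm hU hΦU hxU
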